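/- Setting. Let $H$ be a real Hilbert space with inner product $\langle\cdot,\cdot\rangle$ and Hilbert norm $\|\cdot\|_2$, let $\|\cdot\|$ be a norm on $H$ whose unit ball is contained in a ball of $\|\cdot\|_2$ (automatic if $\dim H<\infty$), and let $\|g\|_*=\sup\{\langle g,x\rangle:\|x\|\le 1\}$. Let $Q\subseteq H$ be nonempty, closed and convex, and let $d$ be a prox-function on $Q$: $d$ is continuous on $Q$ and strongly convex there with modulus $1$ with respect to $\|\cdot\|$. Assume that the prox-diameter $(\sup_Q d-\inf_Q d)^{1/2}$ of $Q$ is at most $R$. The problem is to minimize over $Q$ the convex function $f(x)=E_\xi[f(x,\xi)]$, which is assumed to attain its minimum on $Q$. A $(\delta,L,D)$-oracle with convexity parameter $\mu\ge 0$, when called at a point $x\in Q$, draws $\xi$ independently from its distribution and returns $(F(x,\xi),G(x,\xi))\in\mathbb R\times H$, where for all $x,y\in Q$ $$E_\xi\big[\|G(x,\xi)-E_\xi G(x,\xi)\|_*^2\big]\le D,$$ $$\frac{\mu}{2}\|y-x\|^2\le E_\xi[f(y,\xi)]-E_\xi[F(x,\xi)]-\langle E_\xi[G(x,\xi)],y-x\rangle\le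 \frac L2\|y-x\|^2+\delta .$$ A method performs a number of iterations. At each iteration it chooses a point of $Q$ depending only on the oracle answers from the previous iterations, and calls the oracle there a prescribed number of times (a mini-batch). After the last iteration it returns a point $\hat x\in Q$ depending only on the answers received. The method may depend on $H,Q,\|\cdot\|,d,\varepsilon,p$ and on the constants $L,D,R$ (and $\mu$), but not on $f$, on the oracle, on the distribution of $\xi$, or on $\delta$. Theorem. There are absolute constants $C,c>0$ such that the following holds. (1) (Convex case.) For all $H,Q,\|\cdot\|,d,R$ as above, all real $L,D$ and all $\varepsilon>0$, put $K=\max\{1,LR^2/\varepsilon\}$. There is a family of methods with parameter $p\in[0,1]$ such that the method with parameter $p$ makes at most $$C\max\Big\{K^{\frac1{p+1}},\ \frac{DR^2}{\varepsilon^2}\Big\}$$ oracle calls and at most $C\,K^{\frac1{p+1}}$ iterations, and such that $E f(\hat x)-\min_Q f\le\varepsilon$ for every convex $f$ and every $(\delta,L,D)$-oracle for $f$ with $\mu=0$ and $\delta\le c\,\varepsilon K^{-\frac p{p+1}}$. (If $\varepsilon\le LR^2$, then $K=LR^2/\varepsilon$.) (2) (Strongly convex case, Euclidean setup: $\|\cdot\|=\|\cdot\|_2$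 and $d(x)=\frac12\|x-x_0\|_2^2$ for some $x_0\in H$; the constants are written $L_2,D_2,R_2$.) For all $H,Q,x_0,R_2$ as above, all $L_2\ge\mu_2>0$, all real $D_2$ and all $\varepsilon>0$ there is a family of methods with parameter $p\in[0,1]$ such that the method with parameter $p$ makes at most $$C\max\Big\{\Big(\frac{L_2}{\mu_2}\Big)^{\frac1{p+1}}\max\Big\{1,\Big\lceil\ln\frac{\mu_2R_2^2}{\varepsilon}\Big\rceil\Big\},\ \frac{D_2}{\mu_2\varepsilon}\Big\}$$ oracle calls and at most $$C\Big(\frac{L_2}{\mu_2}\Big)^{\frac1{p+1}}\max\Big\{1,\Big\lceil\ln\frac{L_2R_2^2}{\varepsilon}\Big\rceil\Big\}$$ iterations, and such that $E f(\hat x)-\min_Q f\le\varepsilon$ for every function $f$ that is $\mu_2$-strongly convex on $Q$ in $\|\cdot\|_2$ and every $(\delta,L_2,D_2)$-oracle for $f$ with $\mu=\mu_2$ and $\delta\le c\,\varepsilon(\mu_2/L_2)^{\frac p{p+1}}$. (In (2), if $R_2=0$, the expressions $\max\{1,\lceil\ln 0\rceil\}$ are read as $1$.) -/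

import Mathlib

open MeasureTheory ProbabilityTheory
open scoped RealInnerProductSpace

universe u v w

/-- The dual norm `‖g‖_* = sup {⟪g, x⟫ : N x ≤ 1}` of a norm `N` given on a Hilbert space `H`;
linear functionals are represented by vectors through the inner product of `H`. -/
noncomputable def dualNorm {H : Type u} [NormedAddCommGroup H] [InnerProductSpace ℝ H]
    (N : Seminorm ℝ H) (g : H) : ℝ :=
  sSup ((fun x : H => ⟪g, x⟫) '' {x : H | N x ≤ 1})

/-- The unit ball of `N` is contained in some ball of the Hilbert norm. In particular `N` is a
norm. Every norm on a finite-dimensional space has this property, and so has every norm whose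
unit ball is contained in the Hilbert unit ball (`K = 1`). -/
def DominatesHilbertNorm {H : Type u} [NormedAddCommGroup H] [InnerProductSpace ℝ H]
    (N : Seminorm ℝ H) : Prop :=
  ∃ K : ℝ, ∀ x : H, ‖x‖ ≤ K * N x

/-- A prox-function (distance generating function) on `Q` for the norm `N`: continuous on `Q`
and strongly convex there with modulus `1` with respect to `N`. -/
structure IsProxFunction {H : Type u} [NormedAddCommGroup H] [InnerProductSpace ℝ H]
    (Q : Set H) (N : Seminorm ℝ H) (d : H → ℝ) : Prop where
  continuousOn : ContinuousOn d Q
  strongConvex : ∀ x ∈ Q, ∀ y ∈ Q, ∀ a b : ℝ, 0 ≤ a → 0 ≤ b → a + b = 1 →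
    d (a • x + b • y) ≤ a * d x + b * d y - a * b / 2 * N (x - y) ^ 2

/-- The prox-diameter `(sup_Q d - inf_Q d) ^ (1/2)` of `Q` is at most `R`. -/
def ProxDiameterLE {H : Type u} (Q : Set H) (d : H → ℝ) (R : ℝ) : Prop :=
  ∀ x ∈ Q, ∀ y ∈ Q, d x - d y ≤ R ^ 2

/-- Joint measurability of `h (x, ξ)` on `S × Ξ` for every separable `S ⊆ Q`. If `H` is separable,
this is joint measurability on `Q × Ξ`. -/
def JointlyMeasurableOn {H : Type u} [TopologicalSpace H] [MeasurableSpace H]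
    {Ξ : Type v} [MeasurableSpace Ξ] {E : Type*} [TopologicalSpace E]
    (Q : Set H) (h : H → Ξ → E) : Prop :=
  ∀ S : Set H, S ⊆ Q → TopologicalSpace.IsSeparable S →
    StronglyMeasurable (fun z : S × Ξ => h z.1 z.2)

/-- The objective `f(x) = E_ξ f(x, ξ)`, where `ξ` has distribution `P`. -/
noncomputable def meanObjective {H : Type u} {Ξ : Type v} [MeasurableSpace Ξ]
    (P : Measure Ξ) (φ : H → Ξ → ℝ) (x : H) : ℝ :=
  ∫ ξ, φ x ξ ∂P

/-- `φ(x, ξ)` is a stochastic integrand on `Q`: jointly measurable, with finite expectation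
at each point of `Q`. -/
structure IsStochasticIntegrand {H : Type u} [TopologicalSpace H] [MeasurableSpace H]
    {Ξ : Type v} [MeasurableSpace Ξ] (Q : Set H) (P : Measure Ξ) (φ : H → Ξ → ℝ) : Prop where
  measurable : JointlyMeasurableOn Q φ
  integrable : ∀ x ∈ Q, Integrable (φ x) P

/-- `(F, G)` is a `(δ, L, D)`-oracle, with convexity parameter `μ` and norm `N`, for the problem of
minimizing `E_ξ φ(x, ξ)` over `Q`. -/
structure IsStochasticOracle {H : Type u} [NormedAddCommGroup H] [InnerProductSpace ℝ H]
    [MeasurableSpace H] {Ξ : Type v} [MeasurableSpace Ξ]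
    (Q : Set H) (N : Seminorm ℝ H) (P : Measure Ξ) (φ F : H → Ξ → ℝ) (G : H → Ξ → H)
    (μ δ L D : ℝ) : Prop where
  measurable_F : JointlyMeasurableOn Q F
  measurable_G : JointlyMeasurableOn Q G
  integrable_F : ∀ x ∈ Q, Integrable (F x) P
  integrable_G : ∀ x ∈ Q, Integrable (G x) P
  integrable_sq : ∀ x ∈ Q, Integrable (fun ξ => dualNorm N (G x ξ - ∫ ζ, G x ζ ∂P) ^ 2) P
  variance_le : ∀ x ∈ Q, ∫ ξ, dualNorm N (G x ξ - ∫ ζ, G x ζ ∂P) ^ 2 ∂P ≤ D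
  lower : ∀ x ∈ Q, ∀ y ∈ Q, μ / 2 * N (y - x) ^ 2 ≤
    (∫ ξ, φ y ξ ∂P) - (∫ ξ, F x ξ ∂P) - ⟪∫ ξ, G x ξ ∂P, y - x⟫
  upper : ∀ x ∈ Q, ∀ y ∈ Q,
    (∫ ξ, φ y ξ ∂P) - (∫ ξ, F x ξ ∂P) - ⟪∫ ξ, G x ξ ∂P, y - x⟫ ≤ L / 2 * N (y - x) ^ 2 + δ

/-- An iterative method with mini-batches. It performs `iters` iterations; at iteration `k` it calls
the oracle `batch k` times at one query point of `Q`. The query point is a function of the answers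
received at the previous iterations (the list of the previous batches, oldest first), and the
output is a function of all the answers. The method has no other access to the problem. -/
structure BatchMethod {H : Type u} (Q : Set H) where
  iters : ℕ
  batch : ℕ → ℕ
  query : List (List (ℝ × H)) → H
  output : List (List (ℝ × H)) → H
  query_mem : ∀ h, query h ∈ Q
  output_mem : ∀ h, output h ∈ Q

namespace BatchMethod

/-- The total number of oracle calls. -/
def calls {H : Type u} {Q : Set H} (M : BatchMethod Q) : ℕ :=
  ∑ k ∈ Finset.range M.iters, M.batch k

/-- The answers received in the first `k` iterations, when the `i`-th call of iteration `j` is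
answered with the sample `s (j, i)`. -/
def history {H : Type u} {Q : Set H} {Ξ : Type v} (M : BatchMethod Q)
    (F : H → Ξ → ℝ) (G : H → Ξ → H) (s : ℕ × ℕ → Ξ) : ℕ → List (List (ℝ × H))
  | 0 => []
  | k + 1 =>
    let h := M.history F G s k
    h ++ [List.ofFn fun i : Fin (M.batch k) =>
      (F (M.query h) (s (k, i)), G (M.query h) (s (k, i)))]

/-- The point returned after all the iterations. -/
def result {H : Type u} {Q : Set H} {Ξ : Type v} (M : BatchMethod Q)
    (F : H → Ξ → ℝ) (G : H → Ξ → H) (s : ℕ × ℕ → Ξ) : H :=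
  M.output (M.history F G s M.iters)

/-- `E f(x_out) - min_Q f ≤ ε` (and the expectation exists), when the calls are answered with
independent samples of the distribution `P`; `f(x) = E_ξ φ(x, ξ)`. -/
def SolvesInMean {H : Type u} {Q : Set H} {Ξ : Type v} [MeasurableSpace Ξ] (M : BatchMethod Q)
    (P : Measure Ξ) (φ F : H → Ξ → ℝ) (G : H → Ξ → H) (ε : ℝ) : Prop :=
  ∀ (Ω : Type w) [MeasurableSpace Ω] (Pr : Measure Ω) [IsProbabilityMeasure Pr]
    (s : ℕ × ℕ → Ω → Ξ), (∀ i, Measurable (s i)) → iIndepFun s Pr → (∀ i, Pr.map (s i) = P) →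
    Integrable (fun ω => meanObjective P φ (M.result F G fun i => s i ω)) Pr ∧
    ∀ xmin ∈ Q, IsMinOn (meanObjective P φ) Q xmin →
      (∫ ω, meanObjective P φ (M.result F G fun i => s i ω) ∂Pr) - meanObjective P φ xmin ≤ ε

end BatchMethod

set_option linter.unusedSectionVars false

/-! ### Duality between `N` and `dualNorm N` -/

section DualNorm

variable {H : Type u} [NormedAddCommGroup H] [InnerProductSpace ℝ H] {N : Seminorm ℝ H}

/-! The method is accelerated dual averaging with a tunable amount of acceleration. It keeps a dual
vector `γ` (weighted sum of averaged stochastic gradients), the point `prox γ` and a primal average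
`y`. With step weight `α`, past total weight `A` and coupling weight `B`, it queries at weight `α /
B` on `prox γ`, adds `α` times the batch average to `γ`, and averages the new prox point into `y`
with weight `α / (A + α)`. The potential `A (f y - f x*) + proxGap x* γ` grows per step by at most
`B δ` plus noise (`potential_step`). Any `B` between `α` and `A + α` with `2 L α² ≤ B` is allowed,
and a small `B` limits the accumulation of `δ`.

The dual norm need not be Hilbertian, so the averaged noise of a batch cannot be assumed to have
variance `D / m`. Instead, the `m` samples of a batch are treated as `m` successive dual
perturbations of weight `α / m`: each noise term is paired with a comparison point that depends only
on earlier samples, so the linear terms vanish in expectation and the quadratic ones add up to `α² D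
/ m` (`le_proxValue_sum`, `expected_potential_step`).

With `α_t` proportional to `θ (t + 1) / L`, summation over `T` steps (`expected_stage`) gives a gap
of order `L / (θ T²)` times the initial `proxGap`, plus `(1 + θ T) δ`, plus `θ T D / (L m)`. The
choice `θ = T ^ (p - 1) / 2`, `T ≈ 32 K ^ (1 / (p + 1))` gives `θ T = T ^ p / 2`, hence rate `1 / T
^ (p + 1)` and error accumulation `T ^ p`: no growth of the error at `p = 0`, full acceleration at
`p = 1`.

In the convex case one stage suffices. In the strongly convex case the stage is restarted from its
own output: resetting `γ` to `x₀ - y` recentres the prox-function at `y`, and strong convexity turns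
a function gap back into a distance, so each stage halves the accuracy. Batch sizes grow
geometrically, so the noise-driven part of the call count is dominated by the last stages. -/

theorem DominatesHilbertNorm.exists_pos (hN : DominatesHilbertNorm N) :
    ∃ K : ℝ, 0 < K ∧ ∀ x : H, ‖x‖ ≤ K * N x := by
  obtain ⟨K, hK⟩ := hN
  refine ⟨max K 1, by positivity, fun x => (hK x).trans ?_⟩
  exact mul_le_mul_of_nonneg_right (le_max_left _ _) (apply_nonneg N x)

theorem DominatesHilbertNorm.bddAbove (hN : DominatesHilbertNorm N) (g : H) :
    BddAbove ((fun x : H => ⟪g, x⟫) '' {x : H | N x ≤ 1}) := by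
  obtain ⟨K, hK0, hK⟩ := hN.exists_pos
  refine ⟨‖g‖ * K, ?_⟩
  rintro _ ⟨x, hx, rfl⟩
  refine (real_inner_le_norm g x).trans (mul_le_mul_of_nonneg_left ?_ (norm_nonneg g))
  exact (hK x).trans (mul_le_of_le_one_right hK0.le hx)

theorem DominatesHilbertNorm.inner_le_dualNorm (hN : DominatesHilbertNorm N) (g : H) {x : H}
    (hx : N x ≤ 1) : ⟪g, x⟫ ≤ dualNorm N g :=
  le_csSup (hN.bddAbove g) ⟨x, hx, rfl⟩

theorem DominatesHilbertNorm.dualNorm_nonneg (hN : DominatesHilbertNorm N) (g : H) :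
    0 ≤ dualNorm N g := by
  simpa using hN.inner_le_dualNorm g (x := 0) (by simp)

theorem DominatesHilbertNorm.inner_le (hN : DominatesHilbertNorm N) (g x : H) :
    ⟪g, x⟫ ≤ dualNorm N g * N x := by
  obtain ⟨K, hK0, hK⟩ := hN.exists_pos
  rcases (apply_nonneg N x).eq_or_lt with h | h
  · have hx : x = 0 := by
      have := hK x
      rw [← h, mul_zero] at this
      exact norm_le_zero_iff.1 this
    simp [hx]
  · have h1 := hN.inner_le_dualNorm g (x := (N x)⁻¹ • x) (by
      rw [map_smul_eq_mul, norm_inv, Real.norm_of_nonneg h.le, inv_mul_cancel₀ h.ne'])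
    rw [inner_smul_right, inv_mul_le_iff₀ h] at h1
    linarith

theorem DominatesHilbertNorm.abs_inner_le (hN : DominatesHilbertNorm N) (g x : H) :
    |⟪g, x⟫| ≤ dualNorm N g * N x := by
  refine abs_le'.2 ⟨hN.inner_le g x, ?_⟩
  have := hN.inner_le g (-x)
  rwa [inner_neg_right, map_neg_eq_map] at this

/-- The `N`-unit ball lies in a Hilbert ball of radius `K`, which makes the dual norm `K`-Lipschitz.
Continuity is what makes noise norms measurable. -/
theorem DominatesHilbertNorm.continuous_dualNorm (hN : DominatesHilbertNorm N) :
    Continuous (dualNorm N) := by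
  obtain ⟨K, hK0, hK⟩ := hN.exists_pos
  have h1 : ∀ g h : H, dualNorm N g ≤ dualNorm N h + K * ‖g - h‖ := by
    intro g h
    refine csSup_le ⟨_, 0, by simp, rfl⟩ ?_
    rintro _ ⟨x, hx, rfl⟩
    have h2 : ⟪g, x⟫ = ⟪h, x⟫ + ⟪g - h, x⟫ := by rw [← inner_add_left]; simp
    have h3 := real_inner_le_norm (g - h) x
    have h4 : ‖x‖ ≤ K := (hK x).trans (mul_le_of_le_one_right hK0.le hx)
    have h5 := mul_le_mul_of_nonneg_left h4 (norm_nonneg (g - h))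
    have h6 := hN.inner_le_dualNorm h hx
    change ⟪g, x⟫ ≤ _
    linarith
  refine (LipschitzWith.of_le_add_mul ⟨K, hK0.le⟩ fun g h => ?_).continuous
  rw [dist_eq_norm]
  exact h1 g h

end DualNorm

/-! ### The prox map and the concave value function `proxValue` -/

section Prox

variable {H : Type u} [NormedAddCommGroup H] [InnerProductSpace ℝ H] {N : Seminorm ℝ H}
  {Q : Set H} {d : H → ℝ}

/-- A function that is strongly convex along the segments issuing from a minimizer `p` grows
quadratically away from `p`. -/
theorem growth_of_le {E : Type*} [AddCommGroup E] [Module ℝ E] {h : E → ℝ} {p u : E} {c : ℝ}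
    (hmin : ∀ t : ℝ, 0 < t → t < 1 → h p ≤ h (t • u + (1 - t) • p))
    (hconv : ∀ t : ℝ, 0 < t → t < 1 →
      h (t • u + (1 - t) • p) ≤ t * h u + (1 - t) * h p - t * (1 - t) / 2 * c) :
    h p + c / 2 ≤ h u := by
  have key : ∀ t : ℝ, 0 < t → t < 1 → (1 - t) / 2 * c ≤ h u - h p := by
    intro t h0 h1
    have h2 := (hmin t h0 h1).trans (hconv t h0 h1)
    have h3 : t * ((1 - t) / 2 * c) ≤ t * (h u - h p) := by linarith
    exact le_of_mul_le_mul_left h3 h0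
  -- After division by `t`, the full constant `c / 2` appears only in the limit `t → 0`.
  have hlim : Filter.Tendsto (fun t : ℝ => (1 - t) / 2 * c) (nhdsWithin 0 (Set.Ioi 0))
      (nhds (c / 2)) := by
    have : Continuous fun t : ℝ => (1 - t) / 2 * c := by fun_prop
    have h2 := (this.tendsto 0).mono_left (nhdsWithin_le_nhds (s := Set.Ioi 0))
    convert h2 using 2
    ring
  have := le_of_tendsto hlim (b := h u - h p) (by
    filter_upwards [Ioo_mem_nhdsGT (zero_lt_one' ℝ)] with t ht
    exact key t ht.1 ht.2)
  linarith

/-- `prox γ` minimizes `⟪γ, ·⟫ + d` over `Q`, with quadratic growth away from the minimizer. -/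
structure IsProxMap (Q : Set H) (N : Seminorm ℝ H) (d : H → ℝ) (prox : H → H) : Prop where
  mem : ∀ γ, prox γ ∈ Q
  growth : ∀ γ, ∀ u ∈ Q,
    ⟪γ, prox γ⟫ + d (prox γ) + N (u - prox γ) ^ 2 / 2 ≤ ⟪γ, u⟫ + d u

/-- Strong convexity at the midpoint, whose `d`-value is within `R²` of both endpoint values. Thus
`Q` is bounded in `N`, the source of most integrability below. -/
theorem IsProxFunction.sq_le (hd : IsProxFunction Q N d) (hQ : Convex ℝ Q) {R : ℝ}
    (hR : ProxDiameterLE Q d R) {x y : H} (hx : x ∈ Q) (hy : y ∈ Q) :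
    N (x - y) ^ 2 ≤ 8 * R ^ 2 := by
  have h1 := hd.strongConvex x hx y hy (1 / 2) (1 / 2) (by norm_num) (by norm_num) (by norm_num)
  have hm := hQ hx hy (a := 1 / 2) (b := 1 / 2) (by norm_num) (by norm_num) (by norm_num)
  have h2 := hR x hx _ hm
  have h3 := hR y hy _ hm
  linarith

/-- No compactness is needed: the midpoint inequality makes a minimizing sequence Cauchy in `N`,
hence in the Hilbert norm, and `Q` is closed in a complete space. -/
theorem IsProxFunction.exists_proxMap [CompleteSpace H] (hd : IsProxFunction Q N d)
    (hne : Q.Nonempty) (hcl : IsClosed Q) (hQ : Convex ℝ Q) (hN : DominatesHilbertNorm N)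
    {R : ℝ} (hR : ProxDiameterLE Q d R) : ∃ prox : H → H, IsProxMap Q N d prox := by
  obtain ⟨K, hK0, hK⟩ := hN.exists_pos
  obtain ⟨q, hq⟩ := hne
  suffices h : ∀ γ : H, ∃ p ∈ Q, ∀ u ∈ Q,
      ⟪γ, p⟫ + d p + N (u - p) ^ 2 / 2 ≤ ⟪γ, u⟫ + d u by
    choose prox h1 h2 using h
    exact ⟨prox, h1, h2⟩
  intro γ
  set h : H → ℝ := fun u => ⟪γ, u⟫ + d u with hh
  have hsc : ∀ x ∈ Q, ∀ y ∈ Q, ∀ a b : ℝ, 0 ≤ a → 0 ≤ b → a + b = 1 →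
      h (a • x + b • y) ≤ a * h x + b * h y - a * b / 2 * N (x - y) ^ 2 := by
    intro x hx y hy a b ha hb hab
    have := hd.strongConvex x hx y hy a b ha hb hab
    simp only [hh, inner_add_right, inner_smul_right]
    linarith
  have hbdd : BddBelow (h '' Q) := by
    refine ⟨-(‖γ‖ * (K * (8 * R ^ 2 + 1))) + ⟪γ, q⟫ + d q - R ^ 2, ?_⟩
    rintro _ ⟨u, hu, rfl⟩
    have h1 := hR q hq u hu
    have h2 : N (u - q) ≤ 8 * R ^ 2 + 1 := by
      nlinarith [hd.sq_le hQ hR hu hq, sq_nonneg (N (u - q) - 1), sq_nonneg R]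
    have h3 := neg_le_of_abs_le (abs_real_inner_le_norm γ (u - q))
    have h4 := mul_le_mul_of_nonneg_left
      ((hK (u - q)).trans (mul_le_mul_of_nonneg_left h2 hK0.le)) (norm_nonneg γ)
    rw [inner_sub_right] at h3
    simp only [hh]
    linarith
  set I := sInf (h '' Q) with hI
  have hle : ∀ u ∈ Q, I ≤ h u := fun u hu => csInf_le hbdd ⟨u, hu, rfl⟩
  have hseq : ∀ n : ℕ, ∃ x ∈ Q, h x < I + 1 / ((n : ℝ) + 1) := by
    intro n
    obtain ⟨_, ⟨x, hx, rfl⟩, h2⟩ := exists_lt_of_csInf_lt (Set.Nonempty.image h ⟨q, hq⟩)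
      (lt_add_of_pos_right I (Nat.one_div_pos_of_nat (α := ℝ) (n := n)))
    exact ⟨x, hx, h2⟩
  choose x hxQ hx using hseq
  have hdist : ∀ n m k : ℕ, k ≤ n → k ≤ m →
      dist (x n) (x m) ≤ K * √(8 * (1 / ((k : ℝ) + 1))) := by
    intro n m k hn hm
    have h1 := hsc _ (hxQ n) _ (hxQ m) (1 / 2) (1 / 2) (by norm_num) (by norm_num) (by norm_num)
    have h2 := hle _ (hQ (hxQ n) (hxQ m) (a := 1 / 2) (b := 1 / 2) (by norm_num) (by norm_num)
      (by norm_num))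
    have h3 := Nat.one_div_le_one_div (α := ℝ) hn
    have h4 := Nat.one_div_le_one_div (α := ℝ) hm
    rw [dist_eq_norm]
    refine (hK _).trans (mul_le_mul_of_nonneg_left (Real.le_sqrt_of_sq_le ?_) hK0.le)
    linarith [hx n, hx m]
  have hcau : CauchySeq x := by
    refine cauchySeq_of_le_tendsto_0 (fun k : ℕ => K * √(8 * (1 / ((k : ℝ) + 1)))) hdist ?_
    have h0 := tendsto_one_div_add_atTop_nhds_zero_nat (𝕜 := ℝ)
    have h1 := (Real.continuous_sqrt.tendsto _).comp (h0.const_mul 8)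
    simpa using h1.const_mul K
  obtain ⟨p, hp⟩ := cauchySeq_tendsto_of_complete hcau
  have hpQ : p ∈ Q := hcl.mem_of_tendsto hp (Filter.Eventually.of_forall hxQ)
  have hcont : ContinuousOn h Q :=
    (Continuous.inner continuous_const continuous_id).continuousOn.add hd.continuousOn
  have hpI : h p ≤ I := by
    have h1 : Filter.Tendsto (fun n => h (x n)) Filter.atTop (nhds (h p)) :=
      (hcont p hpQ).tendsto.comp
        (tendsto_nhdsWithin_iff.2 ⟨hp, Filter.Eventually.of_forall hxQ⟩)
    have h0 := (tendsto_one_div_add_atTop_nhds_zero_nat (𝕜 := ℝ)).const_add I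
    rw [add_zero] at h0
    exact le_of_tendsto_of_tendsto' h1 h0 fun n => (hx n).le
  refine ⟨p, hpQ, fun u hu => ?_⟩
  refine growth_of_le (h := h) (fun t h0 h1 => hpI.trans (hle _ ?_)) fun t h0 h1 => ?_
  · exact hQ hu hpQ h0.le (by linarith) (by ring)
  · exact hsc u hu p hpQ t (1 - t) h0.le (by linarith) (by ring)

variable {prox : H → H}

/-- Adding the growth inequalities at `γ` and `γ'` gives strong monotonicity, hence a Lipschitz
bound with constant `K²`. -/
theorem IsProxMap.continuous (hp : IsProxMap Q N d prox) (hN : DominatesHilbertNorm N) :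
    Continuous prox := by
  obtain ⟨K, hK0, hK⟩ := hN.exists_pos
  refine (LipschitzWith.of_dist_le_mul (K := ⟨K ^ 2, by positivity⟩) fun γ γ' => ?_).continuous
  rw [dist_eq_norm, dist_eq_norm]
  change _ ≤ K ^ 2 * ‖γ - γ'‖
  have h1 := hp.growth γ _ (hp.mem γ')
  have h2 := hp.growth γ' _ (hp.mem γ)
  rw [map_sub_rev] at h1
  have h3 : N (prox γ - prox γ') ^ 2 ≤ ⟪γ' - γ, prox γ - prox γ'⟫ := by
    simp only [inner_sub_left, inner_sub_right]
    linarith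
  have h4 := h3.trans (real_inner_le_norm _ _)
  have h5 := pow_le_pow_left₀ (norm_nonneg _) (hK (prox γ - prox γ')) 2
  rw [norm_sub_rev γ' γ] at h4
  rcases (norm_nonneg (prox γ - prox γ')).eq_or_lt with h | h
  · rw [← h]; positivity
  · refine le_of_mul_le_mul_right ?_ h
    nlinarith [mul_le_mul_of_nonneg_left h4 (sq_nonneg K)]

/-- The minimal value of `⟪γ, ·⟫ + d` over `Q`. -/
noncomputable def proxValue (d : H → ℝ) (prox : H → H) (γ : H) : ℝ := ⟪γ, prox γ⟫ + d (prox γ)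

theorem IsProxMap.proxValue_le (hp : IsProxMap Q N d prox) (γ : H) {u : H} (hu : u ∈ Q) :
    proxValue d prox γ ≤ ⟪γ, u⟫ + d u := by
  have := hp.growth γ u hu
  have h2 := sq_nonneg (N (u - prox γ))
  unfold proxValue
  linarith

/-- The dual form of strong convexity: the concave function `proxValue` has slope `prox γ` at `γ`
and falls below its linearization by at most half the squared dual norm. -/
theorem IsProxMap.le_proxValue_add (hp : IsProxMap Q N d prox) (hN : DominatesHilbertNorm N)
    (γ η : H) :
    proxValue d prox γ + ⟪η, prox γ⟫ - dualNorm N η ^ 2 / 2 ≤ proxValue d prox (γ + η) := by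
  have h1 := hp.growth γ _ (hp.mem (γ + η))
  have h2 := hN.abs_inner_le η (prox (γ + η) - prox γ)
  have h3 := neg_le_of_abs_le h2
  rw [inner_sub_right] at h3
  unfold proxValue
  rw [inner_add_left]
  nlinarith [sq_nonneg (dualNorm N η - N (prox (γ + η) - prox γ))]

/-- Perturbations are added one at a time, so each `η j` is paired with a prox point built from the
preceding ones only; this later yields martingale differences. -/
theorem IsProxMap.le_proxValue_sum (hp : IsProxMap Q N d prox) (hN : DominatesHilbertNorm N)
    (γ : H) (η : ℕ → H) (m : ℕ) :
    proxValue d prox γ + ∑ j ∈ Finset.range m,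
        (⟪η j, prox (γ + ∑ i ∈ Finset.range j, η i)⟫ - dualNorm N (η j) ^ 2 / 2) ≤
      proxValue d prox (γ + ∑ j ∈ Finset.range m, η j) := by
  induction m with
  | zero => simp
  | succ m ih =>
    have := hp.le_proxValue_add hN (γ + ∑ j ∈ Finset.range m, η j) (η m)
    rw [Finset.sum_range_succ, Finset.sum_range_succ, ← add_assoc γ]
    linarith

/-- The value gap at `x` of the function `⟪γ, ·⟫ + d`. -/
noncomputable def proxGap (d : H → ℝ) (prox : H → H) (x γ : H) : ℝ :=
  ⟪γ, x⟫ + d x - proxValue d prox γ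

theorem IsProxMap.proxGap_nonneg (hp : IsProxMap Q N d prox) (γ : H) {u : H} (hu : u ∈ Q) :
    0 ≤ proxGap d prox u γ := sub_nonneg.2 (hp.proxValue_le γ hu)

end Prox

/-! ### One iteration, pathwise -/

section PotentialStep

variable {H : Type u} [NormedAddCommGroup H] [InnerProductSpace ℝ H] {N : Seminorm ℝ H}
  {Q : Set H} {d : H → ℝ} {prox : H → H}

theorem DominatesHilbertNorm.dualNorm_smul_le (hN : DominatesHilbertNorm N) {c : ℝ} (hc : 0 ≤ c)
    (g : H) : dualNorm N (c • g) ≤ c * dualNorm N g := by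
  refine csSup_le ⟨_, 0, by simp, rfl⟩ ?_
  rintro _ ⟨x, hx, rfl⟩
  change ⟪c • g, x⟫ ≤ _
  rw [real_inner_smul_left]
  exact mul_le_mul_of_nonneg_left (hN.inner_le_dualNorm g hx) hc

/-- The point with weights `b` on `z` and `1 - b` on `y`. -/
noncomputable def mixPoint {E : Type*} [AddCommGroup E] [Module ℝ E] (b : ℝ) (z y : E) : E :=
  b • z + (1 - b) • y

theorem mixPoint_mem {z y : H} (hQ : Convex ℝ Q) (hz : z ∈ Q) (hy : y ∈ Q) {b : ℝ} (h0 : 0 ≤ b)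
    (h1 : b ≤ 1) : mixPoint b z y ∈ Q :=
  hQ hz hy h0 (sub_nonneg.2 h1) (by ring)

/-- The inexact upper model is applied not at the new average but at `w`, the query point with `z`
replaced by `z'`, so it costs `B δ` rather than `(A + α) δ`. Since `w - x = (α / B) (z' - z)`, the
condition `2 L α² ≤ B` bounds the quadratic term by `N (z' - z)² / 4`. -/
theorem coupling_step {f : H → ℝ} (hf : ConvexOn ℝ Q f) {α A B L δ F : ℝ} {g y z z' : H}
    (hα : 0 < α) (hA : 0 ≤ A) (hαB : α ≤ B) (hBA : B ≤ A + α) (hL : 2 * L * α ^ 2 ≤ B)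
    (hy : y ∈ Q) (hz' : z' ∈ Q)
    (hlow : ∀ u ∈ Q, 0 ≤ f u - F - ⟪g, u - mixPoint (α / B) z y⟫)
    (hup : ∀ u ∈ Q, f u - F - ⟪g, u - mixPoint (α / B) z y⟫ ≤
      L / 2 * N (u - mixPoint (α / B) z y) ^ 2 + δ) :
    (A + α) * f (mixPoint (α / (A + α)) z' y) ≤
      A * f y + α * (F + ⟪g, z' - mixPoint (α / B) z y⟫) + N (z' - z) ^ 2 / 4 + B * δ := by
  have hB : 0 < B := hα.trans_le hαB
  have hA' : 0 < A + α := by linarith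
  set x := mixPoint (α / B) z y with hx
  set w := mixPoint (α / B) z' y with hw
  have hwQ : w ∈ Q := mixPoint_mem hf.1 hz' hy (by positivity) ((div_le_one hB).2 hαB)
  -- The new average lies between `w` and `y` because `B ≤ A + α`; convexity of `f` covers the
  -- remaining weight `A + α - B`.
  have hy' : mixPoint (α / (A + α)) z' y = (B / (A + α)) • w + (1 - B / (A + α)) • y := by
    simp only [hw, mixPoint, smul_add, smul_smul, add_assoc, ← add_smul]
    congr 2 <;> field_simp
    ring
  have hwx : w - x = (α / B) • (z' - z) := by
    simp only [hw, hx, mixPoint, smul_sub]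
    abel
  have h1 := hf.2 hwQ hy (show 0 ≤ B / (A + α) by positivity)
    (sub_nonneg.2 ((div_le_one hA').2 hBA)) (by ring)
  rw [← hy', smul_eq_mul, smul_eq_mul] at h1
  have h2 : (A + α) * f (mixPoint (α / (A + α)) z' y) ≤ B * f w + (A + α - B) * f y := by
    have := mul_le_mul_of_nonneg_left h1 hA'.le
    refine this.trans (le_of_eq ?_)
    field_simp
  have h3 := mul_le_mul_of_nonneg_left (hup w hwQ) hB.le
  have h4 : B * ⟪g, w - x⟫ = α * ⟪g, z' - x⟫ + (B - α) * ⟪g, y - x⟫ := by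
    have : w - x = (α / B) • (z' - x) + (1 - α / B) • (y - x) := by
      simp only [hw, mixPoint, smul_sub, sub_smul]
      module
    rw [this, inner_add_right, inner_smul_right, inner_smul_right]
    field_simp
  -- The weight `B - α` of the linear model at `y` is absorbed by the exact lower bound, at no cost
  -- in `δ`.
  have h5 := mul_nonneg (sub_nonneg.2 hαB) (hlow y hy)
  have h6 : B * (L / 2 * N (w - x) ^ 2) ≤ N (z' - z) ^ 2 / 4 := by
    rw [hwx, map_smul_eq_mul, Real.norm_of_nonneg (by positivity), mul_pow]
    have : B * (L / 2 * ((α / B) ^ 2 * N (z' - z) ^ 2)) =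
        (2 * L * α ^ 2 / B) * (N (z' - z) ^ 2 / 4) := by
      field_simp
      ring
    rw [this]
    exact mul_le_of_le_one_left (by positivity) ((div_le_one hB).2 hL)
  linarith

/-- The objective `⟪γ, ·⟫ + d` at the new prox point is split into halves. One half supplies, by
quadratic growth, the `N (z' - z)² / 4` required by `coupling_step`; the other is used against the
noise. -/
theorem potential_step (hp : IsProxMap Q N d prox) (hN : DominatesHilbertNorm N)
    {f : H → ℝ} (hf : ConvexOn ℝ Q f) {α A B L δ F : ℝ} {g y γ γ' xs : H}
    (hα : 0 < α) (hA : 0 ≤ A) (hαB : α ≤ B) (hBA : B ≤ A + α) (hL : 2 * L * α ^ 2 ≤ B)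
    (hy : y ∈ Q) (hxs : xs ∈ Q)
    (hlow : ∀ u ∈ Q, 0 ≤ f u - F - ⟪g, u - mixPoint (α / B) (prox γ) y⟫)
    (hup : ∀ u ∈ Q, f u - F - ⟪g, u - mixPoint (α / B) (prox γ) y⟫ ≤
      L / 2 * N (u - mixPoint (α / B) (prox γ) y) ^ 2 + δ)
    {m : ℕ} (hm : 0 < m) (e : ℕ → H)
    (hγ' : γ' = γ + (α / m) • ∑ j ∈ Finset.range m, (g + e j)) :
    (A + α) * (f (mixPoint (α / (A + α)) (prox γ') y) - f xs) + proxGap d prox xs γ' ≤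
      A * (f y - f xs) + proxGap d prox xs γ + B * δ +
        ∑ j ∈ Finset.range m, ((α / m) ^ 2 * dualNorm N (e j) ^ 2 +
          (α / m) * ⟪e j, xs - prox (γ + ∑ i ∈ Finset.range j, (2 * α / m) • e i)⟫) := by
  have hm' : (0 : ℝ) < m := Nat.cast_pos.2 hm
  set x := mixPoint (α / B) (prox γ) y with hx
  set c : ℝ := α / m with hc
  have hc0 : 0 < c := div_pos hα hm'
  have hcm : c * m = α := by rw [hc]; field_simp
  set S := ∑ j ∈ Finset.range m, e j with hS
  have hγ'' : γ' = γ + α • g + c • S := by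
    rw [hγ', Finset.sum_add_distrib, Finset.sum_const, Finset.card_range, smul_add, ← hS,
      ← Nat.cast_smul_eq_nsmul ℝ, smul_smul, hcm, add_assoc]
  have h1 := coupling_step hf hα hA hαB hBA hL hy (hp.mem γ') hlow hup
  have h2 := hp.growth γ _ (hp.mem γ')
  -- Only half of the objective is available here, so the noise enters with doubled weight `2 c`.
  have h3 := hp.le_proxValue_sum hN γ (fun i => (2 * c) • e i) m
  rw [← Finset.smul_sum, ← hS] at h3
  have h4 := hp.proxValue_le (γ + (2 * c) • S) (hp.mem γ')
  have h5 := mul_nonneg hα.le (hlow xs hxs)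
  have h6 : ∑ j ∈ Finset.range m,
      (c * ⟪e j, prox (γ + ∑ i ∈ Finset.range j, (2 * c) • e i)⟫ - c ^ 2 * dualNorm N (e j) ^ 2) ≤
      (∑ j ∈ Finset.range m,
        (⟪(2 * c) • e j, prox (γ + ∑ i ∈ Finset.range j, (2 * c) • e i)⟫ -
          dualNorm N ((2 * c) • e j) ^ 2 / 2)) / 2 := by
    rw [Finset.sum_div]
    refine Finset.sum_le_sum fun j _ => ?_
    have h7 := pow_le_pow_left₀ (hN.dualNorm_nonneg _)
      (hN.dualNorm_smul_le (by positivity : 0 ≤ 2 * c) (e j)) 2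
    rw [real_inner_smul_left]
    nlinarith
  have h8 : ∑ j ∈ Finset.range m, (c ^ 2 * dualNorm N (e j) ^ 2 +
          c * ⟪e j, xs - prox (γ + ∑ i ∈ Finset.range j, (2 * c) • e i)⟫) =
      c * ⟪S, xs⟫ - ∑ j ∈ Finset.range m,
      (c * ⟪e j, prox (γ + ∑ i ∈ Finset.range j, (2 * c) • e i)⟫ -
        c ^ 2 * dualNorm N (e j) ^ 2) := by
    rw [hS, sum_inner, Finset.mul_sum, ← Finset.sum_sub_distrib]
    refine Finset.sum_congr rfl fun j _ => ?_
    rw [inner_sub_right]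
    ring
  have h9 : 2 * α / m = 2 * c := by rw [hc]; ring
  rw [h9, h8]
  have e1 : proxValue d prox γ' = ⟪γ, prox γ'⟫ + α * ⟪g, prox γ'⟫ + c * ⟪S, prox γ'⟫ +
      d (prox γ') := by
    rw [proxValue]
    nth_rewrite 1 [hγ'']
    rw [inner_add_left, inner_add_left, real_inner_smul_left, real_inner_smul_left]
  have e2 : ⟪γ', xs⟫ = ⟪γ, xs⟫ + α * ⟪g, xs⟫ + c * ⟪S, xs⟫ := by
    rw [hγ'', inner_add_left, inner_add_left, real_inner_smul_left, real_inner_smul_left]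
  rw [inner_add_left, real_inner_smul_left] at h4
  rw [inner_sub_right] at h1 h5
  unfold proxGap
  rw [e1, e2]
  have h2' : proxValue d prox γ + N (prox γ' - prox γ) ^ 2 / 2 ≤
    ⟪γ, prox γ'⟫ + d (prox γ') := h2
  linarith

end PotentialStep

/-! ### Measurability, and independence of fresh samples from the past -/

section Noise

variable {H : Type u} [NormedAddCommGroup H] [InnerProductSpace ℝ H] [CompleteSpace H]
  [MeasurableSpace H] [BorelSpace H] {N : Seminorm ℝ H} {Q : Set H}
  {Ξ : Type v} [MeasurableSpace Ξ] {P : Measure Ξ}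

/-- A strongly measurable map has separable range, so joint measurability over separable subsets
suffices even for nonseparable `H`. -/
theorem JointlyMeasurableOn.comp {E : Type*} [TopologicalSpace E] {h : H → Ξ → E}
    (hh : JointlyMeasurableOn Q h) {α : Type*} [MeasurableSpace α] {X : α → H} {ζ : α → Ξ}
    (hX : StronglyMeasurable X) (hXQ : ∀ a, X a ∈ Q) (hζ : Measurable ζ) :
    StronglyMeasurable fun a => h (X a) (ζ a) := by
  have h1 := hh (Set.range X) (Set.range_subset_iff.2 hXQ) hX.isSeparable_range
  exact h1.comp_measurable (g := fun a => ((⟨X a, a, rfl⟩ : Set.range X), ζ a))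
    (hX.measurable.subtype_mk.prodMk hζ)

theorem JointlyMeasurableOn.integral [SFinite P] {E : Type*} [NormedAddCommGroup E]
    [NormedSpace ℝ E] {h : H → Ξ → E} (hh : JointlyMeasurableOn Q h) {α : Type*}
    [MeasurableSpace α] {X : α → H} (hX : StronglyMeasurable X) (hXQ : ∀ a, X a ∈ Q) :
    StronglyMeasurable fun a => ∫ ξ, h (X a) ξ ∂P := by
  have h1 : StronglyMeasurable fun z : α × Ξ => h (X z.1) z.2 :=
    hh.comp (hX.comp_measurable measurable_fst) (fun z => hXQ z.1) measurable_snd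
  exact h1.integral_prod_right'

variable [IsProbabilityMeasure P] {φ F : H → Ξ → ℝ} {G : H → Ξ → H} {μ δ L D : ℝ}

/-- The deviation of the stochastic gradient from its mean. -/
noncomputable def gradNoise (P : Measure Ξ) (G : H → Ξ → H) (x : H) (ξ : Ξ) : H :=
  G x ξ - ∫ ζ, G x ζ ∂P

theorem IsStochasticOracle.stronglyMeasurable_gradNoise
    (ho : IsStochasticOracle Q N P φ F G μ δ L D) {α : Type*} [MeasurableSpace α] {X : α → H}
    {ζ : α → Ξ} (hX : StronglyMeasurable X) (hXQ : ∀ a, X a ∈ Q) (hζ : Measurable ζ) :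
    StronglyMeasurable fun a => gradNoise P G (X a) (ζ a) :=
  (ho.measurable_G.comp hX hXQ hζ).sub (ho.measurable_G.integral hX hXQ)

theorem IsStochasticOracle.integrable_gradNoise_sq
    (ho : IsStochasticOracle Q N P φ F G μ δ L D) {x : H} (hx : x ∈ Q) :
    Integrable (fun ξ => dualNorm N (gradNoise P G x ξ) ^ 2) P :=
  ho.integrable_sq x hx

theorem IsStochasticOracle.integral_gradNoise_sq_le
    (ho : IsStochasticOracle Q N P φ F G μ δ L D) {x : H} (hx : x ∈ Q) :
    ∫ ξ, dualNorm N (gradNoise P G x ξ) ^ 2 ∂P ≤ D :=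
  ho.variance_le x hx

theorem IsStochasticOracle.integral_gradNoise
    (ho : IsStochasticOracle Q N P φ F G μ δ L D) {x : H} (hx : x ∈ Q) (v : H) :
    ∫ ξ, ⟪gradNoise P G x ξ, v⟫ ∂P = 0 := by
  have hi := ho.integrable_G x hx
  have h2 : Integrable (gradNoise P G x) P := hi.sub (integrable_const _)
  have h3 : ∫ ξ, gradNoise P G x ξ ∂P = 0 := by
    simp [gradNoise, integral_sub hi (integrable_const _)]
  have h4 := integral_inner (𝕜 := ℝ) h2 v
  rw [h3, inner_zero_right] at h4
  simpa only [real_inner_comm] using h4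

/-- Fubini: with the past frozen, the noise has mean zero and second moment at most `D`. The bound
on `N (V a)` makes the pairing integrable. -/
theorem IsStochasticOracle.integral_noise_prod (ho : IsStochasticOracle Q N P φ F G μ δ L D)
    (hN : DominatesHilbertNorm N) {α : Type*} [MeasurableSpace α] (ν : Measure α)
    [IsProbabilityMeasure ν] {X V : α → H} (hX : StronglyMeasurable X) (hXQ : ∀ a, X a ∈ Q)
    (hV : StronglyMeasurable V) {ρ : ℝ} (hρ : ∀ a, N (V a) ≤ ρ) :
    (Integrable (fun z : α × Ξ => dualNorm N (gradNoise P G (X z.1) z.2) ^ 2) (ν.prod P) ∧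
      ∫ z : α × Ξ, dualNorm N (gradNoise P G (X z.1) z.2) ^ 2 ∂(ν.prod P) ≤ D) ∧
    (Integrable (fun z : α × Ξ => ⟪gradNoise P G (X z.1) z.2, V z.1⟫) (ν.prod P) ∧
      ∫ z : α × Ξ, ⟪gradNoise P G (X z.1) z.2, V z.1⟫ ∂(ν.prod P) = 0) := by
  have hE : StronglyMeasurable fun z : α × Ξ => gradNoise P G (X z.1) z.2 :=
    ho.stronglyMeasurable_gradNoise (hX.comp_measurable measurable_fst) (fun z => hXQ z.1)
      measurable_snd
  have hE2 : StronglyMeasurable fun z : α × Ξ => dualNorm N (gradNoise P G (X z.1) z.2) ^ 2 :=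
    (hN.continuous_dualNorm.comp_stronglyMeasurable hE).pow 2
  have hI2 : Integrable (fun z : α × Ξ => dualNorm N (gradNoise P G (X z.1) z.2) ^ 2)
      (ν.prod P) := by
    have hsq : ∀ a, Integrable (fun ξ => dualNorm N (gradNoise P G (X a) ξ) ^ 2) P :=
      fun a => ho.integrable_gradNoise_sq (hXQ a)
    rw [integrable_prod_iff hE2.aestronglyMeasurable]
    refine ⟨Filter.Eventually.of_forall hsq, ?_⟩
    refine Integrable.of_bound (C := D) ?_ (Filter.Eventually.of_forall fun a => ?_)
    · exact (hE2.norm.integral_prod_right').aestronglyMeasurable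
    · rw [Real.norm_of_nonneg (integral_nonneg fun _ => norm_nonneg _)]
      simp only [norm_pow, sq_abs, Real.norm_eq_abs]
      exact ho.integral_gradNoise_sq_le (hXQ a)
  have hIV : Integrable (fun z : α × Ξ => ⟪gradNoise P G (X z.1) z.2, V z.1⟫) (ν.prod P) := by
    refine Integrable.mono' ((hI2.add (integrable_const 1)).mul_const ρ)
      (hE.inner (hV.comp_measurable measurable_fst)).aestronglyMeasurable
      (Filter.Eventually.of_forall fun z => ?_)
    refine (hN.abs_inner_le _ _).trans ?_
    have h0 := hN.dualNorm_nonneg (gradNoise P G (X z.1) z.2)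
    have h1 : dualNorm N (gradNoise P G (X z.1) z.2) ≤
        dualNorm N (gradNoise P G (X z.1) z.2) ^ 2 + 1 := by
      nlinarith [sq_nonneg (dualNorm N (gradNoise P G (X z.1) z.2) - 1)]
    exact mul_le_mul h1 (hρ z.1) (apply_nonneg N _) (h0.trans h1)
  refine ⟨⟨hI2, ?_⟩, hIV, ?_⟩
  · rw [integral_prod _ hI2]
    refine (integral_mono hI2.integral_prod_left (integrable_const D) fun a => ?_).trans ?_
    · exact ho.integral_gradNoise_sq_le (hXQ a)
    · simp
  · rw [integral_prod _ hIV]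
    refine integral_eq_zero_of_ae (Filter.Eventually.of_forall fun a => ?_)
    exact ho.integral_gradNoise (hXQ a) (V a)

variable {Ω : Type w} [mΩ : MeasurableSpace Ω] {Pr : Measure Ω} [IsProbabilityMeasure Pr]

theorem IsStochasticOracle.integral_noise_of_indepFun
    (ho : IsStochasticOracle Q N P φ F G μ δ L D)
    (hN : DominatesHilbertNorm N) {α : Type*} [MeasurableSpace α] {W : Ω → α} {ζ : Ω → Ξ}
    (hW : Measurable W) (hζ : Measurable ζ) (hind : IndepFun W ζ Pr) (hP : Pr.map ζ = P)
    {X V : α → H} (hX : StronglyMeasurable X) (hXQ : ∀ a, X a ∈ Q)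
    (hV : StronglyMeasurable V) {ρ : ℝ} (hρ : ∀ a, N (V a) ≤ ρ) :
    (Integrable (fun ω => dualNorm N (gradNoise P G (X (W ω)) (ζ ω)) ^ 2) Pr ∧
      ∫ ω, dualNorm N (gradNoise P G (X (W ω)) (ζ ω)) ^ 2 ∂Pr ≤ D) ∧
    (Integrable (fun ω => ⟪gradNoise P G (X (W ω)) (ζ ω), V (W ω)⟫) Pr ∧
      ∫ ω, ⟪gradNoise P G (X (W ω)) (ζ ω), V (W ω)⟫ ∂Pr = 0) := by
  have : IsProbabilityMeasure (Pr.map W) := Measure.isProbabilityMeasure_map hW.aemeasurable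
  have hWζ : Measurable fun ω => (W ω, ζ ω) := hW.prodMk hζ
  have hmap : Pr.map (fun ω => (W ω, ζ ω)) = (Pr.map W).prod P := by
    rw [← hP]
    exact (indepFun_iff_map_prod_eq_prod_map_map hW.aemeasurable hζ.aemeasurable).1 hind
  obtain ⟨⟨h1, h2⟩, h3, h4⟩ := ho.integral_noise_prod hN (Pr.map W) hX hXQ hV hρ
  rw [← hmap] at h1 h2 h3 h4
  rw [integral_map hWζ.aemeasurable h1.aestronglyMeasurable] at h2
  rw [integral_map hWζ.aemeasurable h3.aestronglyMeasurable] at h4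
  exact ⟨⟨h1.comp_measurable hWζ, h2⟩, h3.comp_measurable hWζ, h4⟩

theorem IsStochasticOracle.integral_noise
    {Ω : Type w} {m : MeasurableSpace Ω} [mΩ : MeasurableSpace Ω] {Pr : Measure Ω}
    [IsProbabilityMeasure Pr] (ho : IsStochasticOracle Q N P φ F G μ δ L D)
    (hN : DominatesHilbertNorm N) (hm : m ≤ mΩ) {ζ : Ω → Ξ} (hζ : Measurable ζ)
    (hind : Indep m (MeasurableSpace.comap ζ inferInstance) Pr) (hP : Pr.map ζ = P)
    {X V : Ω → H} (hX : StronglyMeasurable[m] X) (hXQ : ∀ ω, X ω ∈ Q)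
    (hV : StronglyMeasurable[m] V) {ρ : ℝ} (hρ : ∀ ω, N (V ω) ≤ ρ) :
    (Integrable (fun ω => dualNorm N (gradNoise P G (X ω) (ζ ω)) ^ 2) Pr ∧
      ∫ ω, dualNorm N (gradNoise P G (X ω) (ζ ω)) ^ 2 ∂Pr ≤ D) ∧
    (Integrable (fun ω => ⟪gradNoise P G (X ω) (ζ ω), V ω⟫) Pr ∧
      ∫ ω, ⟪gradNoise P G (X ω) (ζ ω), V ω⟫ ∂Pr = 0) := by
  -- The past is encoded by the identity map from `Ω` to `Ω` with the coarser σ-algebra `m`.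
  have hid : Measurable[mΩ, m] (id : Ω → Ω) := measurable_id'' hm
  have hi : @IndepFun Ω Ω Ξ mΩ m _ id ζ Pr := by
    refine (@IndepFun_iff_Indep Ω Ω Ξ mΩ m _ id ζ Pr).2 ?_
    rwa [MeasurableSpace.comap_id]
  exact @IsStochasticOracle.integral_noise_of_indepFun H _ _ _ _ _ N Q Ξ _ P _ φ F G μ δ L D Ω mΩ
    Pr _ ho hN Ω m id ζ hid hζ hi hP X V hX hXQ hV ρ hρ

/-- The σ-algebra generated by the samples with index in `S`. -/
@[reducible]
def sampleAlgebra {ι : Type*} (s : ι → Ω → Ξ) (S : Set ι) : MeasurableSpace Ω :=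
  ⨆ i ∈ S, MeasurableSpace.comap (s i) inferInstance

theorem sampleAlgebra_mono {ι : Type*} (s : ι → Ω → Ξ) {S S' : Set ι} (h : S ⊆ S') :
    sampleAlgebra s S ≤ sampleAlgebra s S' :=
  biSup_mono h

theorem sampleAlgebra_le {ι : Type*} {s : ι → Ω → Ξ} (hs : ∀ i, Measurable (s i)) (S : Set ι) :
    sampleAlgebra s S ≤ mΩ :=
  iSup₂_le fun i _ => (hs i).comap_le

theorem measurable_sampleAlgebra {ι : Type*} (s : ι → Ω → Ξ) {S : Set ι} {i : ι} (hi : i ∈ S) :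
    Measurable[sampleAlgebra s S] (s i) :=
  Measurable.of_comap_le (le_biSup (fun i => MeasurableSpace.comap (s i) inferInstance) hi)

theorem indep_sampleAlgebra {ι : Type*} {s : ι → Ω → Ξ} (hs : ∀ i, Measurable (s i))
    (hind : iIndepFun s Pr) {S : Set ι} {i : ι} (hi : i ∉ S) :
    Indep (sampleAlgebra s S) (MeasurableSpace.comap (s i) inferInstance) Pr := by
  have h := indep_iSup_of_disjoint (fun i => (hs i).comap_le) hind
    (Set.disjoint_singleton_right.2 hi)
  rwa [iSup_singleton] at h

end Noise

/-! ### One iteration, in expectation -/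

section ExpectedStep

variable {H : Type u} [NormedAddCommGroup H] [InnerProductSpace ℝ H] [CompleteSpace H]
  [MeasurableSpace H] [BorelSpace H] {N : Seminorm ℝ H} {Q : Set H} {d : H → ℝ} {prox : H → H}
  {Ξ : Type v} [MeasurableSpace Ξ] {P : Measure Ξ} [IsProbabilityMeasure P]
  {φ F : H → Ξ → ℝ} {G : H → Ξ → H} {μ δ L D ρ : ℝ}
  {Ω : Type w} [mΩ : MeasurableSpace Ω] {Pr : Measure Ω} [IsProbabilityMeasure Pr]

theorem IsStochasticOracle.error_nonneg (ho : IsStochasticOracle Q N P φ F G μ δ L D)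
    (hne : Q.Nonempty) : 0 ≤ δ := by
  obtain ⟨q, hq⟩ := hne
  have h1 := ho.lower q hq q hq
  have h2 := ho.upper q hq q hq
  simp only [sub_self, map_zero] at h1 h2
  linarith

theorem IsStochasticOracle.variance_nonneg (ho : IsStochasticOracle Q N P φ F G μ δ L D)
    (hne : Q.Nonempty) : 0 ≤ D := by
  obtain ⟨q, hq⟩ := hne
  exact (integral_nonneg fun _ => sq_nonneg _).trans (ho.variance_le q hq)

theorem IsStochasticOracle.mono (ho : IsStochasticOracle Q N P φ F G μ δ L D) {L' : ℝ}
    (hL : L ≤ L') : IsStochasticOracle Q N P φ F G μ δ L' D :=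
  { ho with
    upper := fun x hx y hy => (ho.upper x hx y hy).trans (by gcongr) }

/-- The oracle model at a single point sandwiches the objective on the `N`-bounded set `Q`. -/
theorem IsStochasticOracle.exists_bound (ho : IsStochasticOracle Q N P φ F G μ δ L D)
    (hN : DominatesHilbertNorm N) (hμ : 0 ≤ μ) (hρ : ∀ u ∈ Q, ∀ v ∈ Q, N (u - v) ≤ ρ) :
    ∃ C : ℝ, ∀ u ∈ Q, |meanObjective P φ u| ≤ C := by
  rcases Q.eq_empty_or_nonempty with rfl | ⟨q, hq⟩
  · exact ⟨0, by simp⟩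
  refine ⟨|∫ ξ, F q ξ ∂P| + dualNorm N (∫ ξ, G q ξ ∂P) * ρ + (|L| / 2 * ρ ^ 2 + δ),
    fun u hu => ?_⟩
  have hδ := ho.error_nonneg ⟨q, hq⟩
  have h1 := ho.lower q hq u hu
  have h2 := ho.upper q hq u hu
  have h3 := abs_le.1 ((hN.abs_inner_le (∫ ξ, G q ξ ∂P) (u - q)).trans
    (mul_le_mul_of_nonneg_left (hρ u hu q hq) (hN.dualNorm_nonneg _)))
  have h4 := pow_le_pow_left₀ (apply_nonneg N _) (hρ u hu q hq) 2
  have h5 : L / 2 * N (u - q) ^ 2 ≤ |L| / 2 * ρ ^ 2 :=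
    mul_le_mul (by linarith [le_abs_self L]) h4 (sq_nonneg _) (by positivity)
  have h6 : 0 ≤ μ / 2 * N (u - q) ^ 2 := by positivity
  have h7 : 0 ≤ |L| / 2 * ρ ^ 2 := by positivity
  have h8 := neg_abs_le (∫ ξ, F q ξ ∂P)
  have h9 := le_abs_self (∫ ξ, F q ξ ∂P)
  unfold meanObjective
  rw [abs_le]
  constructor <;> linarith [h3.1, h3.2]

theorem IsStochasticOracle.integrable_meanObjective
    (ho : IsStochasticOracle Q N P φ F G μ δ L D) (hφ : IsStochasticIntegrand Q P φ)
    (hN : DominatesHilbertNorm N) (hμ : 0 ≤ μ) (hρ : ∀ u ∈ Q, ∀ v ∈ Q, N (u - v) ≤ ρ)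
    {y : Ω → H} (hy : StronglyMeasurable y) (hyQ : ∀ ω, y ω ∈ Q) :
    Integrable (fun ω => meanObjective P φ (y ω)) Pr := by
  obtain ⟨C, hC⟩ := ho.exists_bound hN hμ hρ
  exact Integrable.of_bound (hφ.measurable.integral hy hyQ).aestronglyMeasurable C
    (Filter.Eventually.of_forall fun ω => hC _ (hyQ ω))

theorem IsProxMap.continuous_proxGap (hp : IsProxMap Q N d prox) (hN : DominatesHilbertNorm N)
    (hd : ContinuousOn d Q) (x : H) : Continuous (proxGap d prox x) := by
  have h1 := hp.continuous hN
  have h2 : Continuous fun γ => d (prox γ) := hd.comp_continuous h1 hp.mem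
  unfold proxGap proxValue
  exact ((continuous_id.inner continuous_const).add continuous_const).sub
    ((continuous_id.inner h1).add h2)

theorem mixPoint_stronglyMeasurable {m : MeasurableSpace Ω} {z y : Ω → H} (b : ℝ)
    (hz : StronglyMeasurable[m] z) (hy : StronglyMeasurable[m] y) :
    StronglyMeasurable[m] fun ω => mixPoint b (z ω) (y ω) :=
  (hz.const_smul b).add (hy.const_smul (1 - b))

/-- The σ-algebra of the samples drawn before iteration `n`. -/
@[reducible]
def pastAlgebra (s : ℕ × ℕ → Ω → Ξ) (n : ℕ) : MeasurableSpace Ω :=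
  sampleAlgebra s {i | i.1 < n}

theorem pastAlgebra_le_succ (s : ℕ × ℕ → Ω → Ξ) (n : ℕ) :
    pastAlgebra s n ≤ pastAlgebra s (n + 1) :=
  sampleAlgebra_mono s fun _ hi => Nat.lt_succ_of_lt hi

theorem stronglyMeasurable_batch (hG : JointlyMeasurableOn Q G) {s : ℕ × ℕ → Ω → Ξ} {n : ℕ}
    {γ x γ' : Ω → H} (hγ : StronglyMeasurable[pastAlgebra s n] γ)
    (hx : StronglyMeasurable[pastAlgebra s n] x) (hxQ : ∀ ω, x ω ∈ Q) {c : ℝ} {m : ℕ}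
    (hγ' : ∀ ω, γ' ω = γ ω + c • ∑ j ∈ Finset.range m, G (x ω) (s (n, j) ω)) :
    StronglyMeasurable[pastAlgebra s (n + 1)] γ' := by
  obtain rfl : γ' = fun ω => γ ω + c • ∑ j ∈ Finset.range m, G (x ω) (s (n, j) ω) := funext hγ'
  have hle := pastAlgebra_le_succ s n
  refine (hγ.mono hle).add (StronglyMeasurable.const_smul ?_ c)
  refine Finset.stronglyMeasurable_fun_sum _ fun j _ => ?_
  exact @JointlyMeasurableOn.comp H _ _ _ _ _ Q Ξ _ H _ G hG Ω (pastAlgebra s (n + 1)) x _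
    (hx.mono hle) hxQ (measurable_sampleAlgebra s (Nat.lt_succ_self n))

theorem expected_potential_step (hp : IsProxMap Q N d prox) (hN : DominatesHilbertNorm N)
    (hd : ContinuousOn d Q) (hρ : ∀ u ∈ Q, ∀ v ∈ Q, N (u - v) ≤ ρ)
    (hφ : IsStochasticIntegrand Q P φ) (hf : ConvexOn ℝ Q (meanObjective P φ))
    (ho : IsStochasticOracle Q N P φ F G μ δ L D) (hμ : 0 ≤ μ) {α A B : ℝ}
    (hα : 0 < α) (hA : 0 ≤ A) (hαB : α ≤ B) (hBA : B ≤ A + α) (hL : 2 * L * α ^ 2 ≤ B)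
    {s : ℕ × ℕ → Ω → Ξ} (hs : ∀ i, Measurable (s i)) (hind : iIndepFun s Pr)
    (hP : ∀ i, Pr.map (s i) = P) {n : ℕ} {γ y γ' : Ω → H} {xs : H}
    (hγ : StronglyMeasurable[pastAlgebra s n] γ) (hy : StronglyMeasurable[pastAlgebra s n] y)
    (hyQ : ∀ ω, y ω ∈ Q) (hxs : xs ∈ Q) {m : ℕ} (hm : 0 < m)
    (hγ' : ∀ ω, γ' ω = γ ω + (α / m) • ∑ j ∈ Finset.range m,
      G (mixPoint (α / B) (prox (γ ω)) (y ω)) (s (n, j) ω))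
    (hgap : Integrable (fun ω => proxGap d prox xs (γ ω)) Pr) :
    Integrable (fun ω => proxGap d prox xs (γ' ω)) Pr ∧
    ∫ ω, ((A + α) * (meanObjective P φ (mixPoint (α / (A + α)) (prox (γ' ω)) (y ω)) -
        meanObjective P φ xs) + proxGap d prox xs (γ' ω)) ∂Pr ≤
      ∫ ω, (A * (meanObjective P φ (y ω) - meanObjective P φ xs) +
        proxGap d prox xs (γ ω)) ∂Pr + B * δ + α ^ 2 / m * D := by
  have hm' : (0 : ℝ) < m := Nat.cast_pos.2 hm
  have hB : 0 < B := hα.trans_le hαB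
  have hA' : 0 < A + α := by linarith
  have hpc := hp.continuous hN
  set f := meanObjective P φ with hf_def
  set x : Ω → H := fun ω => mixPoint (α / B) (prox (γ ω)) (y ω) with hx_def
  have hx : StronglyMeasurable[pastAlgebra s n] x :=
    mixPoint_stronglyMeasurable _ (hpc.comp_stronglyMeasurable hγ) hy
  have hxQ : ∀ ω, x ω ∈ Q := fun ω =>
    mixPoint_mem hf.1 (hp.mem _) (hyQ ω) (by positivity) ((div_le_one hB).2 hαB)
  have hle := sampleAlgebra_le hs
  set e : ℕ → Ω → H := fun j ω => gradNoise P G (x ω) (s (n, j) ω) with he_def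
  set u : ℕ → Ω → H := fun j ω =>
    prox (γ ω + ∑ i ∈ Finset.range j, (2 * α / m) • e i ω) with hu_def
  -- The past before sample `j` of batch `n`, in lexicographic order. The query point depends only
  -- on earlier batches, but `u j` also on earlier samples of the same batch.
  set past : ℕ → MeasurableSpace Ω :=
    fun j => sampleAlgebra s {i | i.1 < n ∨ (i.1 = n ∧ i.2 < j)} with hpast
  have hle_past : ∀ j, pastAlgebra s n ≤ past j := fun j =>
    sampleAlgebra_mono s fun i hi => Or.inl hi
  have he : ∀ i j, i < j → StronglyMeasurable[past j] (e i) := fun i j hij =>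
    @IsStochasticOracle.stronglyMeasurable_gradNoise H _ _ _ _ _ N Q Ξ _ P _ φ F G μ δ L D ho Ω
      (past j) x _ (hx.mono (hle_past j)) hxQ
      (measurable_sampleAlgebra s (Or.inr ⟨rfl, hij⟩))
  have hu : ∀ j, StronglyMeasurable[past j] (u j) := fun j =>
    hpc.comp_stronglyMeasurable ((hγ.mono (hle_past j)).add
      (Finset.stronglyMeasurable_fun_sum _ fun i hi =>
        (he i j (Finset.mem_range.1 hi)).const_smul _))
  have hnoise := fun j => ho.integral_noise hN (hle _) (hs (n, j))
    (indep_sampleAlgebra hs hind (S := {i | i.1 < n ∨ (i.1 = n ∧ i.2 < j)}) (i := (n, j))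
      (by simp)) (hP _) (hx.mono (hle_past j)) hxQ
    (V := fun ω => xs - u j ω) (stronglyMeasurable_const.sub (hu j))
    (fun ω => hρ _ hxs _ (hp.mem _))
  have hpoint : ∀ ω, (A + α) * (f (mixPoint (α / (A + α)) (prox (γ' ω)) (y ω)) - f xs) +
      proxGap d prox xs (γ' ω) ≤ A * (f (y ω) - f xs) + proxGap d prox xs (γ ω) + B * δ +
        ∑ j ∈ Finset.range m, ((α / m) ^ 2 * dualNorm N (e j ω) ^ 2 +
          (α / m) * ⟪e j ω, xs - u j ω⟫) := by
    intro ω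
    refine potential_step hp hN hf (F := ∫ ξ, F (x ω) ξ ∂P) (g := ∫ ξ, G (x ω) ξ ∂P)
      hα hA hαB hBA hL (hyQ ω) hxs (fun v hv => ?_) (fun v hv => ?_) hm (fun j => e j ω) ?_
    · exact le_trans (by positivity) (ho.lower _ (hxQ ω) v hv)
    · exact ho.upper _ (hxQ ω) v hv
    · rw [hγ' ω]
      simp only [he_def, gradNoise, add_sub_cancel]
      rfl
  have hfy : Integrable (fun ω => f (y ω)) Pr :=
    ho.integrable_meanObjective hφ hN hμ hρ (hy.mono (hle _)) hyQ
  have hγm : StronglyMeasurable[pastAlgebra s (n + 1)] γ' :=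
    stronglyMeasurable_batch ho.measurable_G hγ hx hxQ hγ'
  have hfy' : Integrable (fun ω => f (mixPoint (α / (A + α)) (prox (γ' ω)) (y ω))) Pr := by
    refine ho.integrable_meanObjective hφ hN hμ hρ (mixPoint_stronglyMeasurable _
      (hpc.comp_stronglyMeasurable (hγm.mono (hle _))) (hy.mono (hle _))) fun ω => ?_
    exact mixPoint_mem hf.1 (hp.mem _) (hyQ ω) (by positivity)
      ((div_le_one hA').2 (by linarith))
  have hsum1 : ∀ j ∈ Finset.range m, Integrable (fun ω => (α / m) ^ 2 * dualNorm N (e j ω) ^ 2 +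
      (α / m) * ⟪e j ω, xs - u j ω⟫) Pr := fun j _ =>
    ((hnoise j).1.1.const_mul _).add ((hnoise j).2.1.const_mul _)
  have hsum := integrable_finsetSum _ hsum1
  have hpot : Integrable (fun ω => A * (f (y ω) - f xs) + proxGap d prox xs (γ ω)) Pr :=
    ((hfy.sub (integrable_const _)).const_mul A).add hgap
  have hpot' : Integrable (fun ω =>
      (A + α) * (f (mixPoint (α / (A + α)) (prox (γ' ω)) (y ω)) - f xs)) Pr :=
    (hfy'.sub (integrable_const _)).const_mul _
  have hpotc : Integrable (fun ω => A * (f (y ω) - f xs) + proxGap d prox xs (γ ω) + B * δ) Pr :=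
    hpot.add (integrable_const _)
  have hrhs : Integrable (fun ω => A * (f (y ω) - f xs) + proxGap d prox xs (γ ω) + B * δ +
      ∑ j ∈ Finset.range m, ((α / m) ^ 2 * dualNorm N (e j ω) ^ 2 +
        (α / m) * ⟪e j ω, xs - u j ω⟫)) Pr :=
    hpotc.add hsum
  -- The potential inequality itself supplies the integrable majorant: the gap is nonnegative and
  -- all other terms are already integrable.
  have hgap' : Integrable (fun ω => proxGap d prox xs (γ' ω)) Pr := by
    refine Integrable.mono' (hrhs.sub hpot') ((hp.continuous_proxGap hN hd xs).comp_stronglyMeasurable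
      (hγm.mono (hle _))).aestronglyMeasurable (Filter.Eventually.of_forall fun ω => ?_)
    rw [Real.norm_of_nonneg (hp.proxGap_nonneg _ hxs)]
    exact le_sub_iff_add_le'.2 (hpoint ω)
  refine ⟨hgap', (integral_mono (hpot'.add hgap') hrhs hpoint).trans ?_⟩
  rw [integral_add hpotc hsum, integral_add hpot (integrable_const _),
    integral_const, integral_finsetSum _ hsum1]
  have h1 : ∀ j ∈ Finset.range m, ∫ ω, ((α / m) ^ 2 * dualNorm N (e j ω) ^ 2 +
      (α / m) * ⟪e j ω, xs - u j ω⟫) ∂Pr ≤ (α / m) ^ 2 * D := by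
    intro j _
    rw [integral_add ((hnoise j).1.1.const_mul _) ((hnoise j).2.1.const_mul _),
      integral_const_mul, integral_const_mul, (hnoise j).2.2, mul_zero, add_zero]
    exact mul_le_mul_of_nonneg_left (hnoise j).1.2 (sq_nonneg _)
  have h2 := Finset.sum_le_sum h1
  rw [Finset.sum_const, Finset.card_range, nsmul_eq_mul] at h2
  have h3 : (m : ℝ) * ((α / m) ^ 2 * D) = α ^ 2 / m * D := by
    field_simp
  rw [h3] at h2
  simp only [probReal_univ, one_smul]
  linarith

end ExpectedStep

/-! ### The weight sequences -/

section Weights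

/-- The weight of iteration `t`. -/
noncomputable def stepWeight (θ L : ℝ) (t : ℕ) : ℝ := θ * (t + 1) / (2 * L)

/-- The coupling weight of iteration `t`. -/
noncomputable def couplingWeight (θ L : ℝ) (t : ℕ) : ℝ :=
  max (θ * (t + 1)) ((θ * (t + 1)) ^ 2) / (2 * L)

/-- The total weight of the iterations before iteration `t`. -/
noncomputable def totalWeight (θ L : ℝ) (t : ℕ) : ℝ := θ * (t * (t + 1) / 2) / (2 * L)

variable {θ L : ℝ}

theorem stepWeight_pos (hθ : 0 < θ) (hL : 0 < L) (t : ℕ) : 0 < stepWeight θ L t := by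
  unfold stepWeight; positivity

theorem totalWeight_zero : totalWeight θ L 0 = 0 := by simp [totalWeight]

theorem totalWeight_nonneg (hθ : 0 < θ) (hL : 0 < L) (t : ℕ) : 0 ≤ totalWeight θ L t := by
  unfold totalWeight; positivity

theorem totalWeight_succ (t : ℕ) :
    totalWeight θ L (t + 1) = totalWeight θ L t + stepWeight θ L t := by
  unfold totalWeight stepWeight
  push_cast
  ring

theorem stepWeight_le_couplingWeight (hL : 0 < L) (t : ℕ) :
    stepWeight θ L t ≤ couplingWeight θ L t := by
  unfold stepWeight couplingWeight
  gcongr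
  exact le_max_left _ _

/-- Here `θ ≤ 1 / 2` is essential: the total weight through step `t` is `θ (t + 1) (t + 2) / 2` over
`2 L`, which must exceed `(θ (t + 1))²` over `2 L`. -/
theorem couplingWeight_le (hθ : 0 < θ) (hθ2 : θ ≤ 1 / 2) (hL : 0 < L) (t : ℕ) :
    couplingWeight θ L t ≤ totalWeight θ L t + stepWeight θ L t := by
  have ht : (0 : ℝ) ≤ t := t.cast_nonneg
  unfold stepWeight couplingWeight totalWeight
  rw [← add_div]
  gcongr
  refine max_le (le_add_of_nonneg_left (by positivity)) ?_
  have h1 : θ * (t + 1) ^ 2 ≤ 1 / 2 * (t + 1) ^ 2 := by gcongr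
  nlinarith [mul_le_mul_of_nonneg_left h1 hθ.le, mul_nonneg hθ.le ht]

theorem sq_stepWeight_le (hL : 0 < L) (t : ℕ) :
    2 * L * stepWeight θ L t ^ 2 ≤ couplingWeight θ L t := by
  have : 2 * L * stepWeight θ L t ^ 2 = (θ * (t + 1)) ^ 2 / (2 * L) := by
    unfold stepWeight
    field_simp
  rw [this]
  unfold couplingWeight
  gcongr
  exact le_max_right _ _

/-- The ratio of coupling weight to step weight is `max 1 (θ (t + 1))`. After summation, `δ` is
therefore amplified only by `1 + θ T`, whereas the coupling `B = A + α` would amplify it by order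
`T`. -/
theorem couplingWeight_le_mul (hθ : 0 < θ) (hL : 0 < L) {t T : ℕ} (ht : t < T) :
    couplingWeight θ L t ≤ stepWeight θ L t * (1 + θ * T) := by
  have ht' : (t : ℝ) + 1 ≤ T := by exact_mod_cast ht
  have h0 : 0 < θ * (t + 1) := by positivity
  have h1 : θ * (t + 1) ≤ θ * T := by gcongr
  unfold stepWeight couplingWeight
  rw [div_mul_eq_mul_div]
  gcongr
  refine max_le ?_ ?_ <;> nlinarith

theorem sq_stepWeight_le_mul (hθ : 0 < θ) (hL : 0 < L) {t T : ℕ} (ht : t < T) :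
    stepWeight θ L t ^ 2 ≤ stepWeight θ L t * (θ * T / (2 * L)) := by
  have ht' : (t : ℝ) + 1 ≤ T := by exact_mod_cast ht
  rw [sq]
  refine mul_le_mul_of_nonneg_left ?_ (stepWeight_pos hθ hL t).le
  unfold stepWeight
  gcongr

end Weights

/-! ### Convergence of one stage -/

section Stage

variable {H : Type u} [NormedAddCommGroup H] [InnerProductSpace ℝ H] [CompleteSpace H]
  [MeasurableSpace H] [BorelSpace H] {N : Seminorm ℝ H} {Q : Set H} {d : H → ℝ} {prox : H → H}
  {Ξ : Type v} [MeasurableSpace Ξ] {P : Measure Ξ} [IsProbabilityMeasure P]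
  {φ F : H → Ξ → ℝ} {G : H → Ξ → H} {μ δ L D ρ θ : ℝ}
  {Ω : Type w} [mΩ : MeasurableSpace Ω] {Pr : Measure Ω} [IsProbabilityMeasure Pr]

/-- The error of a stage of `T` iterations with batches of size `m` that is due to the noise and
the inexactness of the oracle. -/
noncomputable def oracleError (θ L D δ : ℝ) (T m : ℕ) : ℝ :=
  (1 + θ * T) * δ + θ * T / (2 * L) * (D / m)

/-- The convergence of one stage of the method, started with the dual vector `γ 0` and the average
`y 0`. -/
theorem expected_stage (hp : IsProxMap Q N d prox) (hN : DominatesHilbertNorm N)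
    (hd : ContinuousOn d Q) (hρ : ∀ u ∈ Q, ∀ v ∈ Q, N (u - v) ≤ ρ)
    (hφ : IsStochasticIntegrand Q P φ) (hf : ConvexOn ℝ Q (meanObjective P φ))
    (ho : IsStochasticOracle Q N P φ F G μ δ L D) (hμ : 0 ≤ μ)
    (hθ : 0 < θ) (hθ2 : θ ≤ 1 / 2) (hL : 0 < L)
    {s : ℕ × ℕ → Ω → Ξ} (hs : ∀ i, Measurable (s i)) (hind : iIndepFun s Pr)
    (hP : ∀ i, Pr.map (s i) = P) {n T m : ℕ} (hT : 0 < T) (hm : 0 < m) {γ y : ℕ → Ω → H} {xs : H}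
    (hxs : xs ∈ Q)
    (hγ0 : StronglyMeasurable[pastAlgebra s n] (γ 0))
    (hy0 : StronglyMeasurable[pastAlgebra s n] (y 0)) (hyQ : ∀ ω, y 0 ω ∈ Q)
    (hγ : ∀ t < T, ∀ ω, γ (t + 1) ω = γ t ω + (stepWeight θ L t / m) • ∑ j ∈ Finset.range m,
      G (mixPoint (stepWeight θ L t / couplingWeight θ L t) (prox (γ t ω)) (y t ω))
        (s (n + t, j) ω))
    (hy : ∀ t < T, ∀ ω, y (t + 1) ω = mixPoint
      (stepWeight θ L t / (totalWeight θ L t + stepWeight θ L t)) (prox (γ (t + 1) ω)) (y t ω))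
    (hgap : Integrable (fun ω => proxGap d prox xs (γ 0 ω)) Pr) :
    (StronglyMeasurable[pastAlgebra s (n + T)] (y T) ∧ ∀ ω, y T ω ∈ Q) ∧
    ∫ ω, (meanObjective P φ (y T ω) - meanObjective P φ xs) ∂Pr ≤
      4 * L / (θ * T ^ 2) * ∫ ω, proxGap d prox xs (γ 0 ω) ∂Pr + oracleError θ L D δ T m := by
  have hm' : (0 : ℝ) < m := Nat.cast_pos.2 hm
  have hT' : (0 : ℝ) < T := Nat.cast_pos.2 hT
  have hδ := ho.error_nonneg ⟨xs, hxs⟩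
  have hD := ho.variance_nonneg ⟨xs, hxs⟩
  have hpc := hp.continuous hN
  have hle := sampleAlgebra_le hs
  set f := meanObjective P φ
  -- The total weight is zero at `t = 0`, so the initial potential is just the initial gap and the
  -- value at the starting average plays no role.
  have key : ∀ t ≤ T, StronglyMeasurable[pastAlgebra s (n + t)] (γ t) ∧
      StronglyMeasurable[pastAlgebra s (n + t)] (y t) ∧ (∀ ω, y t ω ∈ Q) ∧
      Integrable (fun ω => proxGap d prox xs (γ t ω)) Pr ∧
      ∫ ω, (totalWeight θ L t * (f (y t ω) - f xs) + proxGap d prox xs (γ t ω)) ∂Pr ≤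
        ∫ ω, proxGap d prox xs (γ 0 ω) ∂Pr + totalWeight θ L t * oracleError θ L D δ T m := by
    intro t
    induction t with
    | zero => exact fun _ => ⟨hγ0, hy0, hyQ, hgap, by simp [totalWeight_zero]⟩
    | succ t ih =>
      intro ht
      obtain ⟨h1, h2, h3, h4, h5⟩ := ih (Nat.le_of_succ_le ht)
      have hα := stepWeight_pos hθ hL t
      have hA := totalWeight_nonneg hθ hL t
      have hαB := stepWeight_le_couplingWeight (θ := θ) hL t
      have hBA := couplingWeight_le hθ hθ2 hL t
      have hB := hα.trans_le hαB
      obtain ⟨h6, h7⟩ := expected_potential_step hp hN hd hρ hφ hf ho hμ hα hA hαB hBA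
        (sq_stepWeight_le hL t) hs hind hP h1 h2 h3 hxs hm (hγ t ht) h4
      have hγ' : StronglyMeasurable[pastAlgebra s (n + (t + 1))] (γ (t + 1)) := by
        refine stronglyMeasurable_batch ho.measurable_G h1 (mixPoint_stronglyMeasurable _
          (hpc.comp_stronglyMeasurable h1) h2) (fun ω => ?_) (hγ t ht)
        exact mixPoint_mem hf.1 (hp.mem _) (h3 ω) (by positivity) ((div_le_one hB).2 hαB)
      refine ⟨hγ', ?_, fun ω => ?_, h6, ?_⟩
      · rw [show y (t + 1) = _ from funext (hy t ht)]
        exact mixPoint_stronglyMeasurable _ (hpc.comp_stronglyMeasurable hγ')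
          (h2.mono (pastAlgebra_le_succ s (n + t)))
      · rw [hy t ht ω]
        exact mixPoint_mem hf.1 (hp.mem _) (h3 ω) (by positivity)
          ((div_le_one (by positivity)).2 (by linarith))
      · simp only [← hy t ht] at h7
        rw [← totalWeight_succ] at h7
        refine h7.trans ?_
        have h8 := mul_le_mul_of_nonneg_right (couplingWeight_le_mul hθ hL ht) hδ
        have h9 := mul_le_mul_of_nonneg_right (sq_stepWeight_le_mul hθ hL ht)
          (div_nonneg hD hm'.le)
        have h10 : stepWeight θ L t ^ 2 / m * D = stepWeight θ L t ^ 2 * (D / m) := by ring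
        have h11 : totalWeight θ L (t + 1) * oracleError θ L D δ T m =
            totalWeight θ L t * oracleError θ L D δ T m +
            stepWeight θ L t * (1 + θ * T) * δ +
            stepWeight θ L t * (θ * T / (2 * L)) * (D / m) := by
          rw [totalWeight_succ, oracleError]
          ring
        rw [h10, h11]
        linarith
  obtain ⟨-, h2, h3, h4, h5⟩ := key T le_rfl
  refine ⟨⟨h2, h3⟩, ?_⟩
  have hfy : Integrable (fun ω => f (y T ω) - f xs) Pr :=
    (ho.integrable_meanObjective hφ hN hμ hρ (h2.mono (hle _)) h3).sub (integrable_const _)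
  rw [integral_add (hfy.const_mul _) h4, integral_const_mul] at h5
  have h6 : 0 ≤ ∫ ω, proxGap d prox xs (γ T ω) ∂Pr :=
    integral_nonneg fun ω => hp.proxGap_nonneg _ hxs
  have h7 : 0 ≤ ∫ ω, proxGap d prox xs (γ 0 ω) ∂Pr :=
    integral_nonneg fun ω => hp.proxGap_nonneg _ hxs
  have hA : 0 < totalWeight θ L T := by unfold totalWeight; positivity
  have h8 : ∫ ω, (f (y T ω) - f xs) ∂Pr ≤
      (totalWeight θ L T)⁻¹ * ∫ ω, proxGap d prox xs (γ 0 ω) ∂Pr + oracleError θ L D δ T m := by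
    have h9 : ∫ ω, (f (y T ω) - f xs) ∂Pr ≤ (∫ ω, proxGap d prox xs (γ 0 ω) ∂Pr +
        totalWeight θ L T * oracleError θ L D δ T m) / totalWeight θ L T := by
      rw [le_div_iff₀ hA]
      linarith
    refine h9.trans (le_of_eq ?_)
    field_simp
  refine h8.trans (add_le_add_left (mul_le_mul_of_nonneg_right ?_ h7) _)
  rw [inv_le_comm₀ hA (by positivity), inv_div]
  unfold totalWeight
  rw [div_le_div_iff₀ (by positivity) (by positivity)]
  have : 0 ≤ θ * T * L := by positivity
  linarith

end Stage

/-! ### The algorithm as a function of the answer history -/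

section Method

variable {H : Type u} [NormedAddCommGroup H] [InnerProductSpace ℝ H]

/-- The dual vector used at iteration `n`: it is reset at the beginning of each stage. -/
def stageDual (κ : H → H) (T n : ℕ) (γ y : H) : H := if n % T = 0 then κ y else γ

/-- The query point of iteration `n`, when the dual vector is `γ` and the average is `y`. -/
noncomputable def stagedQuery (prox κ : H → H) (θ L : ℝ) (T : ℕ) (σ : ℕ × H × H) : H :=
  mixPoint (stepWeight θ L (σ.1 % T) / couplingWeight θ L (σ.1 % T))
    (prox (stageDual κ T σ.1 σ.2.1 σ.2.2)) σ.2.2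

/-- The dual vector after an iteration whose oracle answers are `b`. -/
noncomputable def dualUpdate (κ : H → H) (θ L : ℝ) (T : ℕ) (σ : ℕ × H × H)
    (b : List (ℝ × H)) : H :=
  stageDual κ T σ.1 σ.2.1 σ.2.2 +
    (stepWeight θ L (σ.1 % T) / b.length) • (b.map Prod.snd).sum

/-- The state (iteration counter, dual vector, average) after an iteration. -/
noncomputable def stagedStep (prox κ : H → H) (θ L : ℝ) (T : ℕ) (σ : ℕ × H × H)
    (b : List (ℝ × H)) : ℕ × H × H :=
  (σ.1 + 1, dualUpdate κ θ L T σ b,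
    mixPoint (stepWeight θ L (σ.1 % T) / (totalWeight θ L (σ.1 % T) + stepWeight θ L (σ.1 % T)))
      (prox (dualUpdate κ θ L T σ b)) σ.2.2)

/-- The state after the iterations recorded in the history `h`. -/
noncomputable def stagedState (prox κ : H → H) (θ L : ℝ) (T : ℕ) (q : H)
    (h : List (List (ℝ × H))) : ℕ × H × H :=
  h.foldl (stagedStep prox κ θ L T) (0, 0, q)

theorem stagedState_append (prox κ : H → H) (θ L : ℝ) (T : ℕ) (q : H)
    (h : List (List (ℝ × H))) (b : List (ℝ × H)) :
    stagedState prox κ θ L T q (h ++ [b]) =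
      stagedStep prox κ θ L T (stagedState prox κ θ L T q h) b := by
  simp [stagedState]

variable {N : Seminorm ℝ H} {Q : Set H} {d : H → ℝ} {prox κ : H → H} {θ L : ℝ} {T : ℕ} {q : H}

theorem stagedState_mem (hp : IsProxMap Q N d prox) (hQ : Convex ℝ Q) (hθ : 0 < θ) (hL : 0 < L)
    (hq : q ∈ Q) (h : List (List (ℝ × H))) : (stagedState prox κ θ L T q h).2.2 ∈ Q := by
  induction h using List.reverseRecOn with
  | nil => exact hq
  | append_singleton h b ih =>
    rw [stagedState_append]
    set t := (stagedState prox κ θ L T q h).1 % T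
    have h1 := stepWeight_pos hθ hL t
    have h2 := totalWeight_nonneg hθ hL t
    exact mixPoint_mem hQ (hp.mem _) ih (by positivity)
      ((div_le_one (by positivity)).2 (by linarith))

/-- The accelerated dual averaging method with mini-batches, run in `J` stages of `T` iterations.
All batches of stage `j` have size `m j`. -/
noncomputable def stagedMethod (hp : IsProxMap Q N d prox) (hQ : Convex ℝ Q) (hθ : 0 < θ)
    (hL : 0 < L) (hq : q ∈ Q) (κ : H → H) (T J : ℕ) (m : ℕ → ℕ) : BatchMethod Q where
  iters := J * T
  batch n := m (n / T)
  query h := stagedQuery prox κ θ L T (stagedState prox κ θ L T q h)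
  output h := (stagedState prox κ θ L T q h).2.2
  query_mem h := by
    set t := (stagedState prox κ θ L T q h).1 % T
    have h1 := stepWeight_pos hθ hL t
    have h2 := stepWeight_le_couplingWeight (θ := θ) hL t
    exact mixPoint_mem hQ (hp.mem _) (stagedState_mem hp hQ hθ hL hq h)
      (div_nonneg h1.le (h1.le.trans h2)) ((div_le_one (h1.trans_le h2)).2 h2)
  output_mem := stagedState_mem hp hQ hθ hL hq

theorem stagedMethod_calls (hp : IsProxMap Q N d prox) (hQ : Convex ℝ Q) (hθ : 0 < θ)
    (hL : 0 < L) (hq : q ∈ Q) (κ : H → H) {T : ℕ} (hT : 0 < T) (J : ℕ) (m : ℕ → ℕ) :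
    (stagedMethod hp hQ hθ hL hq κ T J m).calls = ∑ j ∈ Finset.range J, T * m j := by
  change ∑ n ∈ Finset.range (J * T), m (n / T) = _
  induction J with
  | zero => simp
  | succ J ih =>
    rw [Nat.succ_mul, Finset.sum_range_add, ih, Finset.sum_range_succ]
    congr 1
    rw [Finset.sum_congr rfl (g := fun _ => m J) fun t ht => ?_, Finset.sum_const,
      Finset.card_range, smul_eq_mul]
    rw [mul_comm, Nat.mul_add_div hT, Nat.div_eq_of_lt (Finset.mem_range.1 ht), add_zero]

variable {Ξ : Type v} (F : H → Ξ → ℝ) (G : H → Ξ → H)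

variable (hp : IsProxMap Q N d prox) (hQ : Convex ℝ Q) (hθ : 0 < θ)
    (hL : 0 < L) (hq : q ∈ Q) (J : ℕ) (m : ℕ → ℕ)

/-- The state of the staged method after `n` iterations with the samples `s`. -/
noncomputable def sampledState (κ : H → H) (T : ℕ) (s : ℕ × ℕ → Ξ) (n : ℕ) : ℕ × H × H :=
  stagedState prox κ θ L T q ((stagedMethod hp hQ hθ hL hq κ T J m).history F G s n)

theorem sampledState_zero (s : ℕ × ℕ → Ξ) :
    sampledState F G hp hQ hθ hL hq J m κ T s 0 = (0, 0, q) := rfl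

theorem sampledState_succ (s : ℕ × ℕ → Ξ) (n : ℕ) :
    sampledState F G hp hQ hθ hL hq J m κ T s (n + 1) =
      stagedStep prox κ θ L T (sampledState F G hp hQ hθ hL hq J m κ T s n)
        (List.ofFn fun i : Fin (m (n / T)) =>
          (F (stagedQuery prox κ θ L T (sampledState F G hp hQ hθ hL hq J m κ T s n)) (s (n, i)),
          G (stagedQuery prox κ θ L T (sampledState F G hp hQ hθ hL hq J m κ T s n))
            (s (n, i)))) :=
  stagedState_append _ _ _ _ _ _ _ _

theorem sampledState_fst (s : ℕ × ℕ → Ξ) (n : ℕ) :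
    (sampledState F G hp hQ hθ hL hq J m κ T s n).1 = n := by
  induction n with
  | zero => rfl
  | succ n ih =>
    rw [sampledState_succ]
    exact congrArg (· + 1) ih

theorem sampledState_dual_succ (s : ℕ × ℕ → Ξ) (n : ℕ) {γ y : H}
    (hγ : stageDual κ T n (sampledState F G hp hQ hθ hL hq J m κ T s n).2.1
      (sampledState F G hp hQ hθ hL hq J m κ T s n).2.2 = γ)
    (hy : (sampledState F G hp hQ hθ hL hq J m κ T s n).2.2 = y) :
    (sampledState F G hp hQ hθ hL hq J m κ T s (n + 1)).2.1 =
      γ + (stepWeight θ L (n % T) / (m (n / T) : ℕ)) • ∑ j ∈ Finset.range (m (n / T)),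
        G (mixPoint (stepWeight θ L (n % T) / couplingWeight θ L (n % T)) (prox γ) y)
          (s (n, j)) := by
  have h1 := sampledState_fst F G hp hQ hθ hL hq J m (κ := κ) (T := T) s n
  subst hγ hy
  rw [sampledState_succ]
  simp only [stagedStep, dualUpdate, stagedQuery, h1, List.length_ofFn, List.map_ofFn,
    List.sum_ofFn]
  rw [Finset.sum_range]
  rfl

theorem sampledState_average_succ (s : ℕ × ℕ → Ξ) (n : ℕ) :
    (sampledState F G hp hQ hθ hL hq J m κ T s (n + 1)).2.2 =
      mixPoint (stepWeight θ L (n % T) / (totalWeight θ L (n % T) + stepWeight θ L (n % T)))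
        (prox (sampledState F G hp hQ hθ hL hq J m κ T s (n + 1)).2.1)
        (sampledState F G hp hQ hθ hL hq J m κ T s n).2.2 := by
  have h1 := sampledState_fst F G hp hQ hθ hL hq J m (κ := κ) (T := T) s n
  rw [sampledState_succ]
  simp only [stagedStep, h1]

end Method

/-! ### Each stage of the algorithm obeys the stage bound -/

section StagedMethod

variable {H : Type u} [NormedAddCommGroup H] [InnerProductSpace ℝ H] [CompleteSpace H]
  [MeasurableSpace H] [BorelSpace H] {N : Seminorm ℝ H} {Q : Set H} {d : H → ℝ}
  {prox κ : H → H} {Ξ : Type v} [MeasurableSpace Ξ] {P : Measure Ξ} [IsProbabilityMeasure P]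
  {φ F : H → Ξ → ℝ} {G : H → Ξ → H} {μ δ L L' D ρ θ : ℝ} {q : H} {T : ℕ}
  {Ω : Type w} [mΩ : MeasurableSpace Ω] {Pr : Measure Ω} [IsProbabilityMeasure Pr]

theorem expected_sampledState (hp : IsProxMap Q N d prox) (hQ : Convex ℝ Q) (hθ : 0 < θ)
    (hL : 0 < L) (hq : q ∈ Q) (J : ℕ) (m : ℕ → ℕ) (hN : DominatesHilbertNorm N)
    (hd : ContinuousOn d Q) (hρ : ∀ u ∈ Q, ∀ v ∈ Q, N (u - v) ≤ ρ)
    (hφ : IsStochasticIntegrand Q P φ) (hf : ConvexOn ℝ Q (meanObjective P φ))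
    (ho : IsStochasticOracle Q N P φ F G μ δ L D) (hμ : 0 ≤ μ) (hθ2 : θ ≤ 1 / 2)
    {s : ℕ × ℕ → Ω → Ξ} (hs : ∀ i, Measurable (s i)) (hind : iIndepFun s Pr)
    (hP : ∀ i, Pr.map (s i) = P) (hT : 0 < T) (hm : ∀ j, 0 < m j) (hκ : Continuous κ)
    {C : ℝ} {xs : H} (hxs : xs ∈ Q) (hgap : ∀ y ∈ Q, proxGap d prox xs (κ y) ≤ C) (j : ℕ) :
    (StronglyMeasurable[pastAlgebra s (j * T)]
        (fun ω => (sampledState F G hp hQ hθ hL hq J m κ T (fun i => s i ω) (j * T)).2.2)) ∧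
    ∫ ω, (meanObjective P φ
          (sampledState F G hp hQ hθ hL hq J m κ T (fun i => s i ω) ((j + 1) * T)).2.2 -
        meanObjective P φ xs) ∂Pr ≤
      4 * L / (θ * T ^ 2) * ∫ ω, proxGap d prox xs
          (κ (sampledState F G hp hQ hθ hL hq J m κ T (fun i => s i ω) (j * T)).2.2) ∂Pr +
        oracleError θ L D δ T (m j) := by
  set S : ℕ → Ω → ℕ × H × H :=
    fun n ω => sampledState F G hp hQ hθ hL hq J m κ T (fun i => s i ω) n with hS
  have hmod : ∀ j t, t < T → (j * T + t) % T = t := fun j t ht => by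
    rw [add_comm, Nat.add_mul_mod_self_right, Nat.mod_eq_of_lt ht]
  have hdiv : ∀ j t, t < T → (j * T + t) / T = j := fun j t ht => by
    rw [mul_comm, Nat.mul_add_div hT, Nat.div_eq_of_lt ht, add_zero]
  have key : ∀ j, StronglyMeasurable[pastAlgebra s (j * T)] (fun ω => (S (j * T) ω).2.2) →
      StronglyMeasurable[pastAlgebra s ((j + 1) * T)] (fun ω => (S ((j + 1) * T) ω).2.2) ∧
      ∫ ω, (meanObjective P φ (S ((j + 1) * T) ω).2.2 - meanObjective P φ xs) ∂Pr ≤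
      4 * L / (θ * T ^ 2) * ∫ ω, proxGap d prox xs (κ (S (j * T) ω).2.2) ∂Pr +
        oracleError θ L D δ T (m j) := by
    intro j hj
    have hκj := hκ.comp_stronglyMeasurable hj
    obtain ⟨⟨h1, -⟩, h3⟩ := expected_stage hp hN hd hρ hφ hf ho hμ hθ hθ2 hL hs hind hP
      (n := j * T) (m := m j) hT (hm j)
      -- The stored state at a stage boundary still holds the dual vector from before the reset, so
      -- the value at `t = 0` is replaced by hand.
      (γ := fun t ω => if t = 0 then κ (S (j * T) ω).2.2 else (S (j * T + t) ω).2.1)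
      (y := fun t ω => (S (j * T + t) ω).2.2) hxs
      (by simpa using hκj) (by simpa using hj)
      (fun ω => stagedState_mem hp hQ hθ hL hq _)
      (fun t ht ω => by
        have h4 : stageDual κ T (j * T + t) (S (j * T + t) ω).2.1 (S (j * T + t) ω).2.2 =
            if t = 0 then κ (S (j * T) ω).2.2 else (S (j * T + t) ω).2.1 := by
          unfold stageDual
          rw [hmod j t ht]
          split_ifs with h
          · rw [h, add_zero]
          · rfl
        have h5 := sampledState_dual_succ F G hp hQ hθ hL hq J m (fun i => s i ω) (j * T + t)
          h4 rfl
        rw [hmod j t ht, hdiv j t ht] at h5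
        simp only [Nat.succ_ne_zero, if_false]
        exact h5)
      (fun t ht ω => by
        have h5 := sampledState_average_succ F G hp hQ hθ hL hq J m (κ := κ) (T := T)
          (fun i => s i ω) (j * T + t)
        rw [hmod j t ht] at h5
        exact h5)
      (by
        refine Integrable.of_bound ((hp.continuous_proxGap hN hd xs).comp_stronglyMeasurable
          (hκj.mono (sampleAlgebra_le hs _))).aestronglyMeasurable C
          (Filter.Eventually.of_forall fun ω => ?_)
        rw [Real.norm_of_nonneg (hp.proxGap_nonneg _ hxs)]
        exact hgap _ (stagedState_mem hp hQ hθ hL hq _))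
    rw [← Nat.succ_mul] at h1 h3
    exact ⟨h1, h3⟩
  have hmeas : ∀ j, StronglyMeasurable[pastAlgebra s (j * T)] (fun ω => (S (j * T) ω).2.2) := by
    intro j
    induction j with
    | zero =>
      simp only [hS, zero_mul, sampledState_zero]
      exact stronglyMeasurable_const
    | succ j ih => exact (key j ih).1
  exact ⟨hmeas j, (key j (hmeas j)).2⟩

end StagedMethod

/-! ### Stage length, weight scale and batch size -/

section Parameters

/-- The number of iterations in a stage, for the condition number `K` and the parameter `p`. -/
noncomputable def horizon (K p : ℝ) : ℕ := ⌈32 * K ^ (1 / (p + 1))⌉₊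

variable {K p : ℝ}

theorem le_horizon (K p : ℝ) : 32 * K ^ (1 / (p + 1)) ≤ horizon K p := Nat.le_ceil _

theorem one_le_root (hK : 1 ≤ K) (hp : 0 ≤ p) : 1 ≤ K ^ (1 / (p + 1)) :=
  Real.one_le_rpow hK (by positivity)

theorem one_le_horizon (hK : 1 ≤ K) (hp : 0 ≤ p) : (1 : ℝ) ≤ horizon K p := by
  linarith [le_horizon K p, one_le_root hK hp]

theorem horizon_le (hK : 1 ≤ K) (hp : 0 ≤ p) : (horizon K p : ℝ) ≤ 33 * K ^ (1 / (p + 1)) := by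
  have h1 := one_le_root hK hp
  have h2 := Nat.ceil_lt_add_one (a := 32 * K ^ (1 / (p + 1))) (by positivity)
  unfold horizon
  linarith

theorem one_le_horizon_rpow (hK : 1 ≤ K) (hp : 0 ≤ p) : 1 ≤ (horizon K p : ℝ) ^ p :=
  Real.one_le_rpow (one_le_horizon hK hp) hp

theorem horizon_rpow_le_self (hK : 1 ≤ K) (hp : 0 ≤ p) (hp1 : p ≤ 1) :
    (horizon K p : ℝ) ^ p ≤ horizon K p := by
  simpa using Real.rpow_le_rpow_of_exponent_le (one_le_horizon hK hp) hp1

theorem mul_le_horizon_rpow_mul (hK : 1 ≤ K) (hp : 0 ≤ p) :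
    32 * K ≤ (horizon K p : ℝ) ^ p * horizon K p := by
  have h1 := one_le_horizon hK hp
  have hp1 : p + 1 ≠ 0 := by positivity
  rw [← Real.rpow_add_one (by positivity)]
  have h2 := Real.rpow_le_rpow (by positivity) (le_horizon K p) (by positivity : 0 ≤ p + 1)
  refine le_trans ?_ h2
  rw [Real.mul_rpow (by norm_num) (by positivity), ← Real.rpow_mul (by positivity),
    one_div_mul_cancel hp1, Real.rpow_one]
  have h3 : (32 : ℝ) ^ (1 : ℝ) ≤ 32 ^ (p + 1) :=
    Real.rpow_le_rpow_of_exponent_le (by norm_num) (by linarith)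
  rw [Real.rpow_one] at h3
  gcongr

theorem horizon_rpow_le (hK : 1 ≤ K) (hp : 0 ≤ p) (hp1 : p ≤ 1) :
    (horizon K p : ℝ) ^ p ≤ 33 * K ^ (p / (p + 1)) := by
  have h2 := Real.rpow_le_rpow (by positivity) (horizon_le hK hp) hp
  refine h2.trans ?_
  rw [Real.mul_rpow (by norm_num) (by positivity), ← Real.rpow_mul (by positivity),
    one_div_mul_eq_div]
  have h3 : (33 : ℝ) ^ p ≤ 33 ^ (1 : ℝ) :=
    Real.rpow_le_rpow_of_exponent_le (by norm_num) hp1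
  rw [Real.rpow_one] at h3
  gcongr

theorem horizon_rpow_mul_le (hK : 1 ≤ K) (hp : 0 ≤ p) (hp1 : p ≤ 1) :
    (horizon K p : ℝ) ^ p * horizon K p ≤ 1089 * K := by
  have hp1' : p + 1 ≠ 0 := by positivity
  have h1 := mul_le_mul (horizon_rpow_le hK hp hp1) (horizon_le hK hp) (by positivity)
    (by positivity)
  refine h1.trans (le_of_eq ?_)
  have h2 : K ^ (p / (p + 1)) * K ^ (1 / (p + 1)) = K := by
    rw [← Real.rpow_add (by positivity), ← add_div, div_self hp1', Real.rpow_one]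
  linear_combination 1089 * h2

/-- The scale of the weights of the method. -/
noncomputable def weightScale (K p : ℝ) : ℝ := (horizon K p : ℝ) ^ p / (2 * horizon K p)

theorem weightScale_pos (hK : 1 ≤ K) (hp : 0 ≤ p) : 0 < weightScale K p := by
  have := one_le_horizon hK hp
  unfold weightScale
  positivity

theorem weightScale_le (hK : 1 ≤ K) (hp : 0 ≤ p) (hp1 : p ≤ 1) : weightScale K p ≤ 1 / 2 := by
  have := one_le_horizon hK hp
  unfold weightScale
  rw [div_le_div_iff₀ (by positivity) (by positivity)]
  linarith [horizon_rpow_le_self hK hp hp1]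

/-- The product `θ T²` equals `T ^ (p + 1) / 2`, which is at least `16 K`; the factor `32` in
`horizon` is chosen for the resulting `1 / 4`. -/
theorem rate_le (hK : 1 ≤ K) (hp : 0 ≤ p) {L : ℝ} (hL : 0 < L) :
    4 * L / (weightScale K p * (horizon K p : ℝ) ^ 2) ≤ L / (4 * K) := by
  have h1 := one_le_horizon hK hp
  have h2 := mul_le_horizon_rpow_mul hK hp
  have h3 := one_le_horizon_rpow hK hp
  have h4 : weightScale K p * (horizon K p : ℝ) ^ 2 =
      (horizon K p : ℝ) ^ p * horizon K p / 2 := by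
    unfold weightScale
    field_simp
  rw [h4, div_le_div_iff₀ (by positivity) (by positivity)]
  nlinarith

/-- Since `θ T = T ^ p / 2` and `1 ≤ T ^ p ≤ 33 K ^ (p / (p + 1))`, the factor `1 + θ T` is at most
`3 / 2 * 33` times that power of `K`, hence the `50`. -/
theorem oracleError_le (hK : 1 ≤ K) (hp : 0 ≤ p) (hp1 : p ≤ 1) {L D δ η : ℝ} {m : ℕ}
    (hL : 0 < L) (hδ : 0 ≤ δ) (hη : 0 < η) (hm : 0 < m)
    (hDm : 2 * D * (horizon K p : ℝ) ^ p / (L * η) ≤ m) :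
    oracleError (weightScale K p) L D δ (horizon K p) m ≤
      50 * (K ^ (p / (p + 1)) * δ) + η / 8 := by
  have h1 := one_le_horizon hK hp
  have h3 := one_le_horizon_rpow hK hp
  have hm' : (0 : ℝ) < m := Nat.cast_pos.2 hm
  have h4 : weightScale K p * horizon K p = (horizon K p : ℝ) ^ p / 2 := by
    unfold weightScale
    field_simp
  unfold oracleError
  rw [h4]
  refine add_le_add ?_ ?_
  · rw [← mul_assoc]
    refine mul_le_mul_of_nonneg_right ?_ hδ
    have := horizon_rpow_le hK hp hp1
    linarith
  · rw [div_le_iff₀ (by positivity)] at hDm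
    have : (horizon K p : ℝ) ^ p / 2 / (2 * L) * (D / m) =
        2 * D * (horizon K p : ℝ) ^ p / (8 * L * m) := by
      field_simp
      ring
    rw [this, div_le_div_iff₀ (by positivity) (by positivity)]
    linarith

/-- The batch size that makes the error due to the noise at most `η / 8`. -/
noncomputable def batchSize (K p L D η : ℝ) : ℕ :=
  ⌈2 * D * (horizon K p : ℝ) ^ p / (L * η)⌉₊ + 1

theorem batchSize_pos (K p L D η : ℝ) : 0 < batchSize K p L D η := Nat.succ_pos _

theorem le_batchSize (K p L D η : ℝ) :
    2 * D * (horizon K p : ℝ) ^ p / (L * η) ≤ batchSize K p L D η := by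
  unfold batchSize
  push_cast
  linarith [Nat.le_ceil (2 * D * (horizon K p : ℝ) ^ p / (L * η))]

/-- The powers of `T` combine to `T ^ (p + 1) ≤ 1089 K`, so the noise part of the cost does not
depend on `p`. The real `D` may be negative here, as no oracle is assumed; hence `max D 0`. -/
theorem horizon_mul_batchSize_le (hK : 1 ≤ K) (hp : 0 ≤ p) (hp1 : p ≤ 1) {L D η : ℝ}
    (hL : 0 < L) (hη : 0 < η) :
    (horizon K p : ℝ) * batchSize K p L D η ≤
      66 * K ^ (1 / (p + 1)) + 2178 * (max D 0 * K / (L * η)) := by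
  have h1 := one_le_horizon hK hp
  have h2 := horizon_le hK hp
  have h3 := horizon_rpow_mul_le hK hp hp1
  set x := 2 * max D 0 * (horizon K p : ℝ) ^ p / (L * η) with hx
  have hx0 : 0 ≤ x := by positivity
  have h4 : (batchSize K p L D η : ℝ) ≤ x + 2 := by
    unfold batchSize
    push_cast
    have h5 : 2 * D * (horizon K p : ℝ) ^ p / (L * η) ≤ x := by
      rw [hx]
      gcongr
      exact le_max_left _ _
    have h6 : (⌈2 * D * (horizon K p : ℝ) ^ p / (L * η)⌉₊ : ℝ) ≤ ⌈x⌉₊ := by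
      exact_mod_cast Nat.ceil_le_ceil h5
    linarith [Nat.ceil_lt_add_one hx0]
  have h7 : horizon K p * x ≤ 2178 * (max D 0 * K / (L * η)) := by
    have h8 : horizon K p * x =
        2 * max D 0 * ((horizon K p : ℝ) ^ p * horizon K p) / (L * η) := by
      rw [hx]
      ring
    have h9 : 2178 * (max D 0 * K / (L * η)) = 2 * max D 0 * (1089 * K) / (L * η) := by ring
    rw [h8, h9]
    gcongr
  have := mul_le_mul_of_nonneg_left h4 (by positivity : (0 : ℝ) ≤ horizon K p)
  linarith

end Parameters

/-! ### The convex case: a single stage -/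

section ConvexCase

variable {H : Type u} [NormedAddCommGroup H] [InnerProductSpace ℝ H] [CompleteSpace H]
  [MeasurableSpace H] [BorelSpace H] {Q : Set H} {N : Seminorm ℝ H} {d : H → ℝ} {L D R ε p : ℝ}

/-- The method without oracle calls that returns `q`. -/
def constMethod {H : Type u} {Q : Set H} {q : H} (hq : q ∈ Q) : BatchMethod Q where
  iters := 0
  batch _ := 0
  query _ := q
  output _ := q
  query_mem _ := hq
  output_mem _ := hq

theorem constMethod_solvesInMean (hε : 0 < ε) {q : H} (hq : q ∈ Q) (hsub : Q.Subsingleton)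
    {Ξ : Type v} [MeasurableSpace Ξ] (P : Measure Ξ) (φ F : H → Ξ → ℝ) (G : H → Ξ → H) :
    BatchMethod.SolvesInMean.{u, v, w} (constMethod hq) P φ F G ε := by
  intro Ω _ Pr _ s _ _ _
  have hint : Integrable (fun _ : Ω => meanObjective P φ q) Pr := integrable_const _
  refine ⟨hint, fun xmin hx _ => ?_⟩
  rw [hsub hx hq]
  change (∫ _ : Ω, meanObjective P φ q ∂Pr) - _ ≤ ε
  simp [hε.le]

theorem IsProxFunction.subsingleton (hd : IsProxFunction Q N d) (hQ : Convex ℝ Q)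
    (hN : DominatesHilbertNorm N) (hR : ProxDiameterLE Q d 0) : Q.Subsingleton := by
  obtain ⟨K, hK0, hK⟩ := hN.exists_pos
  intro x hx y hy
  have h1 := hd.sq_le hQ hR hx hy
  have h2 : N (x - y) = 0 := by
    have : N (x - y) ^ 2 = 0 := le_antisymm (by simpa using h1) (sq_nonneg _)
    exact pow_eq_zero_iff (two_ne_zero) |>.1 this
  have h3 := hK (x - y)
  rw [h2, mul_zero, norm_le_zero_iff, sub_eq_zero] at h3
  exact h3

theorem IsProxFunction.le_sqrt (hd : IsProxFunction Q N d) (hQ : Convex ℝ Q)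
    (hR : ProxDiameterLE Q d R) : ∀ u ∈ Q, ∀ v ∈ Q, N (u - v) ≤ √(8 * R ^ 2) :=
  fun _ hu _ hv => Real.le_sqrt_of_sq_le (hd.sq_le hQ hR hu hv)

theorem exists_method_convex (hne : Q.Nonempty) (hcl : IsClosed Q) (hQ : Convex ℝ Q)
    (hN : DominatesHilbertNorm N) (hd : IsProxFunction Q N d) (hR : ProxDiameterLE Q d R)
    (hε : 0 < ε) (hp0 : 0 ≤ p) (hp1 : p ≤ 1) :
    ∃ M : BatchMethod Q,
      (M.calls : ℝ) ≤
        3000 * max ((max 1 (L * R ^ 2 / ε)) ^ (1 / (p + 1))) (D * R ^ 2 / ε ^ 2) ∧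
      (M.iters : ℝ) ≤ 3000 * (max 1 (L * R ^ 2 / ε)) ^ (1 / (p + 1)) ∧
      ∀ δ : ℝ, δ ≤ 1 / 1000 * (ε / (max 1 (L * R ^ 2 / ε)) ^ (p / (p + 1))) →
        ∀ (Ξ : Type v) [MeasurableSpace Ξ] (P : Measure Ξ) [IsProbabilityMeasure P]
          (φ F : H → Ξ → ℝ) (G : H → Ξ → H),
          IsStochasticIntegrand Q P φ → ConvexOn ℝ Q (meanObjective P φ) →
          IsStochasticOracle Q N P φ F G 0 δ L D →
          BatchMethod.SolvesInMean.{u, v, w} M P φ F G ε := by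
  obtain ⟨q, hq⟩ := id hne
  set K := max 1 (L * R ^ 2 / ε) with hK_def
  have hK : 1 ≤ K := le_max_left _ _
  have hX := one_le_root hK hp0
  -- For `R = 0` the set `Q` is a single point, and `ε / R ^ 2` below would be meaningless.
  rcases eq_or_ne R 0 with rfl | hR0
  · have hsub := hd.subsingleton hQ hN hR
    refine ⟨constMethod hq, ?_, ?_, fun δ _ Ξ _ P _ φ F G _ _ _ =>
      constMethod_solvesInMean hε hq hsub P φ F G⟩
    · simp only [BatchMethod.calls, constMethod, Finset.range_zero, Finset.sum_empty, Nat.cast_zero]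
      exact mul_nonneg (by norm_num) (le_max_of_le_left (by positivity))
    · simp only [constMethod, Nat.cast_zero]
      positivity
  have hR2 : 0 < R ^ 2 := by positivity
  obtain ⟨prox, hprox⟩ := hd.exists_proxMap hne hcl hQ hN hR
  -- Raising `L` keeps the oracle valid, makes the constant positive, and turns the truncated `K`
  -- into exactly `L' R² / ε`.
  set L' := max L (ε / R ^ 2) with hL'_def
  have hL' : 0 < L' := lt_max_of_lt_right (by positivity)
  have hKL : K * ε = L' * R ^ 2 := by
    rw [hK_def, hL'_def, max_mul_of_nonneg _ _ hε.le, max_mul_of_nonneg _ _ hR2.le, max_comm]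
    congr 1 <;> field_simp
  have hT : 0 < horizon K p := by exact_mod_cast zero_lt_one.trans_le (one_le_horizon hK hp0)
  have hθ := weightScale_pos hK hp0
  refine ⟨stagedMethod hprox hQ hθ hL' hq (fun _ => 0) (horizon K p) 1
    (fun _ => batchSize K p L' D ε), ?_, ?_, ?_⟩
  · rw [stagedMethod_calls hprox hQ hθ hL' hq _ hT]
    simp only [Finset.range_one, Finset.sum_singleton]
    push_cast
    refine (horizon_mul_batchSize_le hK hp0 hp1 hL' hε).trans ?_
    have h1 : max D 0 * K / (L' * ε) = max D 0 * R ^ 2 / ε ^ 2 := by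
      rw [div_eq_div_iff (by positivity) (by positivity)]
      linear_combination (max D 0 * ε) * hKL
    have h2 : max D 0 * R ^ 2 / ε ^ 2 ≤ max (K ^ (1 / (p + 1))) (D * R ^ 2 / ε ^ 2) := by
      rcases le_total D 0 with h | h
      · rw [max_eq_right h]
        exact le_max_of_le_left (by simp only [zero_mul, zero_div]; positivity)
      · rw [max_eq_left h]
        exact le_max_right _ _
    have h3 : K ^ (1 / (p + 1)) ≤ max (K ^ (1 / (p + 1))) (D * R ^ 2 / ε ^ 2) := le_max_left _ _
    rw [h1]
    linarith
  · change ((1 * horizon K p : ℕ) : ℝ) ≤ _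
    rw [one_mul]
    linarith [horizon_le hK hp0]
  · intro δ hδ Ξ _ P _ φ F G hφ hf ho Ω _ Pr _ s hs hind hP
    have ho' := ho.mono (le_max_left L (ε / R ^ 2))
    have hρ := hd.le_sqrt hQ hR
    have hgap : ∀ x ∈ Q, proxGap d prox x 0 ≤ R ^ 2 := by
      intro x hx
      have := hR x hx _ (hprox.mem 0)
      simpa [proxGap, proxValue] using this
    have key := fun (xs : H) (hxs : xs ∈ Q) => expected_sampledState hprox hQ hθ hL' hq 1
      (fun _ => batchSize K p L' D ε) hN hd.continuousOn hρ hφ hf ho' le_rfl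
      (weightScale_le hK hp0 hp1) hs hind hP hT (fun _ => batchSize_pos _ _ _ _ _)
      (continuous_const (y := (0 : H))) hxs (fun _ _ => hgap xs hxs)
    have hmeas := ((key q hq 1).1).mono (sampleAlgebra_le hs _)
    have hint : Integrable (fun ω => meanObjective P φ (sampledState F G hprox hQ hθ hL' hq 1
        (fun _ => batchSize K p L' D ε) (fun _ => 0) (horizon K p) (fun i => s i ω)
        (1 * horizon K p)).2.2) Pr :=
      ho'.integrable_meanObjective hφ hN le_rfl hρ hmeas
        (fun ω => stagedState_mem hprox hQ hθ hL' hq _)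
    refine ⟨hint, fun xmin hx _ => ?_⟩
    have h1 := (key xmin hx 0).2
    rw [zero_add, integral_sub hint (integrable_const _)] at h1
    simp only [integral_const, probReal_univ, one_smul] at h1
    refine h1.trans ?_
    -- Error budget: `ε / 4` from the rate, `ε / 20` from `δ`, `ε / 8` from the noise.
    have h2 := oracleError_le hK hp0 hp1 hL' (ho.error_nonneg hne) hε (batchSize_pos _ _ _ _ _)
      (le_batchSize K p L' D ε)
    have h3 : K ^ (p / (p + 1)) * δ ≤ ε / 1000 := by
      have h4 := mul_le_mul_of_nonneg_left hδ (by positivity : 0 ≤ K ^ (p / (p + 1)))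
      refine h4.trans (le_of_eq ?_)
      field_simp
    have h5 := mul_le_mul (rate_le hK hp0 hL') (hgap xmin hx) (hprox.proxGap_nonneg _ hx)
      (by positivity)
    have h6 : L' / (4 * K) * R ^ 2 = ε / 4 := by
      field_simp
      linarith
    linarith

end ConvexCase

/-! ### The strongly convex case: restarts -/

section StronglyConvexCase

variable {H : Type u} [NormedAddCommGroup H] [InnerProductSpace ℝ H] [CompleteSpace H]
  [MeasurableSpace H] [BorelSpace H] {Q : Set H} {x₀ : H} {L D R μ ε p : ℝ}

theorem dominatesHilbertNorm_normSeminorm : DominatesHilbertNorm (normSeminorm ℝ H) :=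
  ⟨1, fun x => by simp⟩

theorem isProxFunction_sq_norm_sub (Q : Set H) (x₀ : H) :
    IsProxFunction Q (normSeminorm ℝ H) fun x => ‖x - x₀‖ ^ 2 / 2 where
  continuousOn := by fun_prop
  strongConvex x _ y _ a b _ _ hab := by
    obtain rfl : b = 1 - a := by linarith
    have h1 : a • x + (1 - a) • y - x₀ = a • (x - x₀) + (1 - a) • (y - x₀) := by module
    have h2 : x - y = (x - x₀) - (y - x₀) := by abel
    simp only [coe_normSeminorm]
    rw [h1, h2]
    generalize x - x₀ = u, y - x₀ = v
    rw [norm_sub_sq_real, norm_add_sq_real, norm_smul, norm_smul, real_inner_smul_left,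
      real_inner_smul_right, mul_pow, mul_pow, Real.norm_eq_abs, Real.norm_eq_abs, sq_abs, sq_abs]
    exact le_of_eq (by ring)

/-- Completing the square: with dual vector `x₀ - y`, the prox objective is `‖y - u‖² / 2` up to a
constant, so a restart is a recentring at `y`. -/
theorem proxGap_sq_norm_sub_le (prox : H → H) (x y : H) :
    proxGap (fun x => ‖x - x₀‖ ^ 2 / 2) prox x (x₀ - y) ≤ ‖y - x‖ ^ 2 / 2 := by
  have h1 : ∀ u : H, ⟪x₀ - y, u⟫ + ‖u - x₀‖ ^ 2 / 2 =
      ‖y - u‖ ^ 2 / 2 + (‖x₀‖ ^ 2 - ‖y‖ ^ 2) / 2 := by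
    intro u
    rw [norm_sub_sq_real, norm_sub_sq_real, inner_sub_left, real_inner_comm x₀ u]
    ring
  unfold proxGap proxValue
  rw [h1, h1]
  linarith [sq_nonneg ‖y - prox (x₀ - y)‖]

theorem StrongConvexOn.sq_norm_sub_le {f : H → ℝ} (hf : StrongConvexOn Q μ f) {x y : H}
    (hx : x ∈ Q) (hy : y ∈ Q) (hmin : IsMinOn f Q x) : μ / 2 * ‖y - x‖ ^ 2 ≤ f y - f x := by
  have h := growth_of_le (h := f) (p := x) (u := y) (c := μ * ‖y - x‖ ^ 2)
    (fun t h0 h1 => hmin (hf.1 hy hx h0.le (by linarith) (by ring)))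
    (fun t h0 h1 => by
      have := hf.2 hy hx h0.le (by linarith : 0 ≤ 1 - t) (by ring)
      simp only [smul_eq_mul] at this
      linarith)
  linarith

/-- The number of stages needed to reach the accuracy `ε`. -/
noncomputable def stageCount (μ R ε : ℝ) : ℕ := 4 * (max 1 ⌈Real.log (μ * R ^ 2 / ε)⌉).toNat

theorem stageCount_cast (μ R ε : ℝ) :
    (stageCount μ R ε : ℝ) = 4 * ((max 1 ⌈Real.log (μ * R ^ 2 / ε)⌉ : ℤ) : ℝ) := by
  have h : (((max 1 ⌈Real.log (μ * R ^ 2 / ε)⌉).toNat : ℤ) : ℝ) =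
      ((max 1 ⌈Real.log (μ * R ^ 2 / ε)⌉ : ℤ) : ℝ) := by
    rw [Int.toNat_of_nonneg (le_max_of_le_left zero_le_one)]
  unfold stageCount
  rw [Nat.cast_mul, ← h, Int.cast_natCast]
  norm_num

/-- With `M` the truncated logarithm, `2 ^ (4 M) = 4 ^ M * 4 ^ M`. One factor dominates `exp M`, as
`e < 4`; the other supplies the `4`, as `M ≥ 1`. -/
theorem le_two_pow_stageCount (hμ : 0 < μ) (hε : 0 < ε) :
    4 * (μ * R ^ 2) ≤ ε * 2 ^ stageCount μ R ε := by
  set M := (max 1 ⌈Real.log (μ * R ^ 2 / ε)⌉).toNat with hM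
  have hM1 : 1 ≤ M := by
    have : (1 : ℤ) ≤ M := by
      rw [hM, Int.toNat_of_nonneg (le_max_of_le_left zero_le_one)]
      exact le_max_left _ _
    exact_mod_cast this
  have hlog : Real.log (μ * R ^ 2 / ε) ≤ M := by
    have h1 : (⌈Real.log (μ * R ^ 2 / ε)⌉ : ℤ) ≤ (M : ℤ) := by
      rw [hM, Int.toNat_of_nonneg (le_max_of_le_left zero_le_one)]
      exact le_max_right _ _
    refine (Int.le_ceil _).trans ?_
    exact_mod_cast h1
  have h4 : μ * R ^ 2 / ε ≤ 4 ^ M := by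
    rcases (by positivity : 0 ≤ μ * R ^ 2 / ε).eq_or_lt with h | h
    · rw [← h]; positivity
    · have h5 := (Real.log_le_iff_le_exp h).1 hlog
      refine h5.trans ?_
      rw [← Real.exp_one_rpow, Real.rpow_natCast]
      exact pow_le_pow_left₀ (Real.exp_pos 1).le (by linarith [Real.exp_one_lt_d9]) M
  have h6 : (4 : ℝ) ≤ 4 ^ M := by
    simpa using pow_le_pow_right₀ (by norm_num : (1 : ℝ) ≤ 4) hM1
  have h7 : (2 : ℝ) ^ stageCount μ R ε = 4 ^ M * 4 ^ M := by
    rw [stageCount, ← hM, pow_mul, ← mul_pow]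
    norm_num
  rw [div_le_iff₀ hε] at h4
  rw [h7]
  have h8 : (4 : ℝ) * (4 ^ M * ε) ≤ 4 ^ M * (4 ^ M * ε) := by gcongr
  linarith

theorem stageCount_mono {L : ℝ} (hμ : 0 < μ) (hL : μ ≤ L) (hε : 0 < ε) :
    ((max 1 ⌈Real.log (μ * R ^ 2 / ε)⌉ : ℤ) : ℝ) ≤
      ((max 1 ⌈Real.log (L * R ^ 2 / ε)⌉ : ℤ) : ℝ) := by
  rcases eq_or_ne R 0 with rfl | hR
  · simp
  have h1 : Real.log (μ * R ^ 2 / ε) ≤ Real.log (L * R ^ 2 / ε) :=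
    Real.log_le_log (by positivity) (by gcongr)
  exact_mod_cast max_le_max le_rfl (Int.ceil_le_ceil h1)

/-- The accuracy with which stage `j` of `J` starts, when the final accuracy is `ε`. -/
noncomputable def stageAccuracy (ε : ℝ) (J j : ℕ) : ℝ := ε * 2 ^ J / 2 ^ j

theorem stageAccuracy_pos (hε : 0 < ε) (J j : ℕ) : 0 < stageAccuracy ε J j := by
  unfold stageAccuracy; positivity

theorem stageAccuracy_succ (ε : ℝ) (J j : ℕ) :
    stageAccuracy ε J (j + 1) = stageAccuracy ε J j / 2 := by
  unfold stageAccuracy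
  rw [pow_succ]
  field_simp

theorem stageAccuracy_self (ε : ℝ) (J : ℕ) : stageAccuracy ε J J = ε := by
  unfold stageAccuracy
  field_simp

theorem le_stageAccuracy (hε : 0 < ε) {J j : ℕ} (hj : j ≤ J) : ε ≤ stageAccuracy ε J j := by
  unfold stageAccuracy
  rw [le_div_iff₀ (by positivity)]
  gcongr
  norm_num

/-- A geometric sum: the noise cost over all stages is comparable to that of the last one, so no
logarithm multiplies `D / (μ ε)`. -/
theorem sum_inv_stageAccuracy_le (hε : 0 < ε) (J : ℕ) :
    ∑ j ∈ Finset.range J, (stageAccuracy ε J j)⁻¹ ≤ ε⁻¹ := by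
  have h1 : ∀ j ∈ Finset.range J, (stageAccuracy ε J j)⁻¹ = (ε * 2 ^ J)⁻¹ * 2 ^ j := by
    intro j _
    unfold stageAccuracy
    field_simp
  rw [Finset.sum_congr rfl h1, ← Finset.mul_sum, geom_sum_eq (by norm_num)]
  have h2 : (ε : ℝ)⁻¹ = (ε * 2 ^ J)⁻¹ * 2 ^ J := by field_simp
  rw [h2]
  gcongr
  norm_num

theorem exists_method_stronglyConvex (hne : Q.Nonempty) (hcl : IsClosed Q) (hQ : Convex ℝ Q)
    (hR : ProxDiameterLE Q (fun x => ‖x - x₀‖ ^ 2 / 2) R) (hμ : 0 < μ) (hμL : μ ≤ L)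
    (hε : 0 < ε) (hp0 : 0 ≤ p) (hp1 : p ≤ 1) :
    ∃ M : BatchMethod Q,
      (M.calls : ℝ) ≤
        3000 * max ((L / μ) ^ (1 / (p + 1)) *
          ((max 1 ⌈Real.log (μ * R ^ 2 / ε)⌉ : ℤ) : ℝ)) (D / (μ * ε)) ∧
      (M.iters : ℝ) ≤
        3000 * ((L / μ) ^ (1 / (p + 1)) *
          ((max 1 ⌈Real.log (L * R ^ 2 / ε)⌉ : ℤ) : ℝ)) ∧
      ∀ δ : ℝ, δ ≤ 1 / 1000 * (ε * (μ / L) ^ (p / (p + 1))) →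
        ∀ (Ξ : Type v) [MeasurableSpace Ξ] (P : Measure Ξ) [IsProbabilityMeasure P]
          (φ F : H → Ξ → ℝ) (G : H → Ξ → H),
          IsStochasticIntegrand Q P φ → StrongConvexOn Q μ (meanObjective P φ) →
          IsStochasticOracle Q (normSeminorm ℝ H) P φ F G μ δ L D →
          BatchMethod.SolvesInMean.{u, v, w} M P φ F G ε := by
  obtain ⟨q, hq⟩ := id hne
  have hL : 0 < L := hμ.trans_le hμL
  set K := L / μ with hK_def
  have hK : 1 ≤ K := (one_le_div hμ).2 hμL
  have hX := one_le_root hK hp0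
  have hN := dominatesHilbertNorm_normSeminorm (H := H)
  have hd := isProxFunction_sq_norm_sub Q x₀
  obtain ⟨prox, hprox⟩ := hd.exists_proxMap hne hcl hQ hN hR
  have hT : 0 < horizon K p := by exact_mod_cast zero_lt_one.trans_le (one_le_horizon hK hp0)
  have hθ := weightScale_pos hK hp0
  set J := stageCount μ R ε with hJ_def
  have hJ := stageCount_cast μ R ε
  have hacc := stageAccuracy_pos hε J
  refine ⟨stagedMethod hprox hQ hθ hL hq (fun y => x₀ - y) (horizon K p) J
    (fun j => batchSize K p L D (stageAccuracy ε J j)), ?_, ?_, ?_⟩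
  · rw [stagedMethod_calls hprox hQ hθ hL hq _ hT, Nat.cast_sum]
    simp only [Nat.cast_mul]
    refine (Finset.sum_le_sum fun j _ => horizon_mul_batchSize_le hK hp0 hp1 hL (hacc j)).trans ?_
    have h1 : ∀ j, max D 0 * K / (L * stageAccuracy ε J j) =
        max D 0 / μ * (stageAccuracy ε J j)⁻¹ := by
      intro j
      have := hacc j
      rw [hK_def]
      field_simp
    simp only [h1]
    rw [Finset.sum_add_distrib, Finset.sum_const, Finset.card_range, nsmul_eq_mul,
      ← Finset.mul_sum, ← Finset.mul_sum, hJ]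
    have h2 := mul_le_mul_of_nonneg_left (sum_inv_stageAccuracy_le hε J)
      (by positivity : 0 ≤ max D 0 / μ)
    set M := ((max 1 ⌈Real.log (μ * R ^ 2 / ε)⌉ : ℤ) : ℝ) with hM
    have hM0 : 0 ≤ M := Int.cast_nonneg (le_max_of_le_left zero_le_one)
    have h3 : max D 0 / μ * ε⁻¹ ≤ max (K ^ (1 / (p + 1)) * M) (D / (μ * ε)) := by
      rcases le_total D 0 with h | h
      · rw [max_eq_right h]
        exact le_max_of_le_left (by simp only [zero_mul, zero_div]; positivity)
      · rw [max_eq_left h]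
        refine le_max_of_le_right (le_of_eq ?_)
        field_simp
    have h4 : K ^ (1 / (p + 1)) * M ≤ max (K ^ (1 / (p + 1)) * M) (D / (μ * ε)) := le_max_left _ _
    have h5 : 0 ≤ K ^ (1 / (p + 1)) * M := by positivity
    linarith
  · change ((J * horizon K p : ℕ) : ℝ) ≤ _
    rw [Nat.cast_mul, hJ]
    have h1 := stageCount_mono (R := R) hμ hμL hε
    have h2 : (0 : ℝ) ≤ ((max 1 ⌈Real.log (μ * R ^ 2 / ε)⌉ : ℤ) : ℝ) :=
      Int.cast_nonneg (le_max_of_le_left zero_le_one)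
    have h3 := mul_le_mul h1 (horizon_le hK hp0) (by positivity) (h2.trans h1)
    have h4 : 0 ≤ ((max 1 ⌈Real.log (L * R ^ 2 / ε)⌉ : ℤ) : ℝ) * K ^ (1 / (p + 1)) :=
      mul_nonneg (h2.trans h1) (by positivity)
    linarith
  · intro δ hδ Ξ _ P _ φ F G hφ hsc ho Ω _ Pr _ s hs hind hP
    have hf : ConvexOn ℝ Q (meanObjective P φ) :=
      UniformConvexOn.convexOn hsc fun r => by positivity
    have hρ := hd.le_sqrt hQ hR
    set S : ℕ → Ω → H := fun j ω => (sampledState F G hprox hQ hθ hL hq J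
        (fun j => batchSize K p L D (stageAccuracy ε J j)) (fun y => x₀ - y) (horizon K p)
        (fun i => s i ω) (j * horizon K p)).2.2 with hS
    have hSQ : ∀ j ω, S j ω ∈ Q := fun j ω => stagedState_mem hprox hQ hθ hL hq _
    have hdist : ∀ x ∈ Q, ∀ y ∈ Q, ‖y - x‖ ^ 2 / 2 ≤ 4 * R ^ 2 := by
      intro x hx y hy
      have h1 := hd.sq_le hQ hR hy hx
      rw [coe_normSeminorm] at h1
      linarith
    have key := fun (xs : H) (hxs : xs ∈ Q) => expected_sampledState hprox hQ hθ hL hq J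
      (fun j => batchSize K p L D (stageAccuracy ε J j)) hN hd.continuousOn hρ hφ hf ho hμ.le
      (weightScale_le hK hp0 hp1) hs hind hP hT (fun _ => batchSize_pos _ _ _ _ _)
      (continuous_const.sub continuous_id : Continuous fun y : H => x₀ - y) hxs
      (fun y hy => (proxGap_sq_norm_sub_le prox xs y).trans (hdist xs hxs y hy))
    have hmeas : ∀ j, StronglyMeasurable (S j) := fun j =>
      ((key q hq j).1).mono (sampleAlgebra_le hs _)
    have hint : ∀ j, Integrable (fun ω => meanObjective P φ (S j ω)) Pr := fun j =>
      ho.integrable_meanObjective hφ hN hμ.le hρ (hmeas j) (hSQ j)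
    refine ⟨hint J, fun xmin hx hmin => ?_⟩
    have hδ' : K ^ (p / (p + 1)) * δ ≤ ε / 1000 := by
      have h4 := mul_le_mul_of_nonneg_left hδ (by positivity : 0 ≤ K ^ (p / (p + 1)))
      refine h4.trans (le_of_eq ?_)
      have h5 : K ^ (p / (p + 1)) * (μ / L) ^ (p / (p + 1)) = 1 := by
        rw [← Real.mul_rpow (by positivity) (by positivity), hK_def, div_mul_div_cancel₀ hμ.ne',
          div_self hL.ne', Real.one_rpow]
      linear_combination (ε / 1000) * h5
    have hsqint : ∀ j, Integrable (fun ω => ‖S j ω - xmin‖ ^ 2 / 2) Pr := fun j =>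
      Integrable.of_bound
        ((by fun_prop : Continuous fun x : H => ‖x - xmin‖ ^ 2 / 2).comp_stronglyMeasurable
          (hmeas j)).aestronglyMeasurable
        (4 * R ^ 2) (Filter.Eventually.of_forall fun ω => by
          rw [Real.norm_of_nonneg (by positivity)]
          exact hdist _ hx _ (hSQ j ω))
    -- With `η` the accuracy at the start of the stage, the new error is at most `η / 4 + η / 20 + η
    -- / 8 ≤ η / 2`; the `δ` term uses `ε ≤ η`.
    have hstage : ∀ j < J, μ * ∫ ω, ‖S j ω - xmin‖ ^ 2 / 2 ∂Pr ≤ stageAccuracy ε J j →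
        ∫ ω, (meanObjective P φ (S (j + 1) ω) - meanObjective P φ xmin) ∂Pr ≤
          stageAccuracy ε J (j + 1) := by
      intro j hj hdj
      have h1 : ∫ ω, (meanObjective P φ (S (j + 1) ω) - meanObjective P φ xmin) ∂Pr ≤
          4 * L / (weightScale K p * (horizon K p : ℝ) ^ 2) *
            ∫ ω, proxGap (fun x => ‖x - x₀‖ ^ 2 / 2) prox xmin (x₀ - S j ω) ∂Pr +
          oracleError (weightScale K p) L D δ (horizon K p)
            (batchSize K p L D (stageAccuracy ε J j)) := (key xmin hx j).2
      refine h1.trans ?_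
      have h2 := oracleError_le hK hp0 hp1 hL (ho.error_nonneg hne) (hacc j) (batchSize_pos _ _ _ _ _)
        (le_batchSize K p L D (stageAccuracy ε J j))
      have h3 : ∫ ω, proxGap (fun x => ‖x - x₀‖ ^ 2 / 2) prox xmin (x₀ - S j ω) ∂Pr ≤
          ∫ ω, ‖S j ω - xmin‖ ^ 2 / 2 ∂Pr :=
        integral_mono_of_nonneg
          (Filter.Eventually.of_forall fun ω => hprox.proxGap_nonneg _ hx) (hsqint j)
          (Filter.Eventually.of_forall fun ω => proxGap_sq_norm_sub_le prox xmin (S j ω))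
      have h5 := mul_le_mul (rate_le hK hp0 hL) h3
        (integral_nonneg fun ω => hprox.proxGap_nonneg _ hx) (by positivity)
      have h6 : L / (4 * K) = μ / 4 := by
        rw [hK_def]
        field_simp
      rw [h6] at h5
      have h7 := le_stageAccuracy hε hj.le
      rw [stageAccuracy_succ]
      linarith
    have hinv : ∀ j ≤ J, μ * ∫ ω, ‖S j ω - xmin‖ ^ 2 / 2 ∂Pr ≤ stageAccuracy ε J j := by
      intro j
      induction j with
      | zero =>
        intro _
        have h1 : ∫ ω, ‖S 0 ω - xmin‖ ^ 2 / 2 ∂Pr ≤ 4 * R ^ 2 := by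
          refine (integral_mono (hsqint 0) (integrable_const _)
            fun ω => hdist _ hx _ (hSQ 0 ω)).trans ?_
          simp
        have h2 := le_two_pow_stageCount (R := R) hμ hε
        have h3 := mul_le_mul_of_nonneg_left h1 hμ.le
        rw [stageAccuracy, pow_zero, div_one]
        linarith
      | succ j ih =>
        intro hj
        -- Quadratic growth at the minimizer converts the function gap reached by the stage into the
        -- distance bound that the next stage needs.
        refine le_trans ?_ (hstage j hj (ih (Nat.le_of_succ_le hj)))
        rw [← integral_const_mul]
        refine integral_mono ((hsqint _).const_mul _) ((hint _).sub (integrable_const _))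
          fun ω => ?_
        have := hsc.sq_norm_sub_le hx (hSQ (j + 1) ω) hmin
        change μ * (‖S (j + 1) ω - xmin‖ ^ 2 / 2) ≤ _
        linarith
    -- The invariant bounds distances only; the final function gap comes from the last stage, so at
    -- least one stage must exist.
    have hJ1 : J = (J - 1) + 1 := by
      have : (1 : ℝ) ≤ J := by
        rw [hJ]
        have : (1 : ℝ) ≤ ((max 1 ⌈Real.log (μ * R ^ 2 / ε)⌉ : ℤ) : ℝ) :=
          Int.cast_one_le_of_pos (zero_lt_one.trans_le (le_max_left _ _))
        linarith
      have : 1 ≤ J := by exact_mod_cast this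
      omega
    have h1 := hstage (J - 1) (by omega) (hinv _ (by omega))
    rw [← hJ1, stageAccuracy_self, integral_sub (hint J) (integrable_const _)] at h1
    simp only [integral_const, probReal_univ, one_smul] at h1
    exact h1

end StronglyConvexCase

theorem mainTheorem1 :
    ∃ C : ℝ, 0 < C ∧ ∃ c : ℝ, 0 < c ∧
      -- the convex case
      (∀ (H : Type u) [NormedAddCommGroup H] [InnerProductSpace ℝ H] [CompleteSpace H]
        [MeasurableSpace H] [BorelSpace H] (Q : Set H) (N : Seminorm ℝ H) (d : H → ℝ)
        (L D R ε : ℝ),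
        Q.Nonempty → IsClosed Q → Convex ℝ Q → DominatesHilbertNorm N →
        IsProxFunction Q N d → ProxDiameterLE Q d R → 0 < ε →
        ∃ M : Set.Icc (0 : ℝ) 1 → BatchMethod Q, ∀ p : Set.Icc (0 : ℝ) 1,
          ((M p).calls : ℝ) ≤
              C * max ((max 1 (L * R ^ 2 / ε)) ^ (1 / ((p : ℝ) + 1))) (D * R ^ 2 / ε ^ 2) ∧
          ((M p).iters : ℝ) ≤ C * (max 1 (L * R ^ 2 / ε)) ^ (1 / ((p : ℝ) + 1)) ∧
          ∀ δ : ℝ, δ ≤ c * (ε / (max 1 (L * R ^ 2 / ε)) ^ ((p : ℝ) / ((p : ℝ) + 1))) →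
            ∀ (Ξ : Type v) [MeasurableSpace Ξ] (P : Measure Ξ) [IsProbabilityMeasure P]
              (φ F : H → Ξ → ℝ) (G : H → Ξ → H),
              IsStochasticIntegrand Q P φ → ConvexOn ℝ Q (meanObjective P φ) →
              IsStochasticOracle Q N P φ F G 0 δ L D →
              BatchMethod.SolvesInMean.{u, v, w} (M p) P φ F G ε) ∧
      -- the strongly convex case, with the Euclidean prox-structure centred at any point `x₀`
      (∀ (H : Type u) [NormedAddCommGroup H] [InnerProductSpace ℝ H] [CompleteSpace H]
        [MeasurableSpace H] [BorelSpace H] (Q : Set H) (x₀ : H) (μ₂ L₂ D₂ R₂ ε : ℝ),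
        Q.Nonempty → IsClosed Q → Convex ℝ Q →
        ProxDiameterLE Q (fun x => ‖x - x₀‖ ^ 2 / 2) R₂ → 0 < μ₂ → μ₂ ≤ L₂ → 0 < ε →
        ∃ M : Set.Icc (0 : ℝ) 1 → BatchMethod Q, ∀ p : Set.Icc (0 : ℝ) 1,
          ((M p).calls : ℝ) ≤
              C * max ((L₂ / μ₂) ^ (1 / ((p : ℝ) + 1)) *
                  ((max 1 ⌈Real.log (μ₂ * R₂ ^ 2 / ε)⌉ : ℤ) : ℝ))
                (D₂ / (μ₂ * ε)) ∧
          ((M p).iters : ℝ) ≤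
              C * ((L₂ / μ₂) ^ (1 / ((p : ℝ) + 1)) *
                  ((max 1 ⌈Real.log (L₂ * R₂ ^ 2 / ε)⌉ : ℤ) : ℝ)) ∧
          ∀ δ : ℝ, δ ≤ c * (ε * (μ₂ / L₂) ^ ((p : ℝ) / ((p : ℝ) + 1))) →
            ∀ (Ξ : Type v) [MeasurableSpace Ξ] (P : Measure Ξ) [IsProbabilityMeasure P]
              (φ F : H → Ξ → ℝ) (G : H → Ξ → H),
              IsStochasticIntegrand Q P φ → StrongConvexOn Q μ₂ (meanObjective P φ) →
              IsStochasticOracle Q (normSeminorm ℝ H) P φ F G μ₂ δ L₂ D₂ →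
              BatchMethod.SolvesInMean.{u, v, w} (M p) P φ F G ε) := by

  refine ⟨3000, by norm_num, 1 / 1000, by norm_num, ?_, ?_⟩
  · intro H _ _ _ _ _ Q N d L D R ε hne hcl hQ hN hd hR hε
    -- The method is chosen separately for each `p`, before `δ`, the oracle and the distribution are
    -- introduced.
    exact ⟨_, fun p => (exists_method_convex (L := L) (D := D) hne hcl hQ hN hd hR hε
      p.2.1 p.2.2).choose_spec⟩
  · intro H _ _ _ _ _ Q x₀ μ₂ L₂ D₂ R₂ ε hne hcl hQ hR hμ hμL hε
    exact ⟨_, fun p => (exists_method_stronglyConvex (D := D₂) hne hcl hQ hR hμ hμL hε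
      p.2.1 p.2.2).choose_spec⟩
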